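/- Let $\phi,\theta:\mathbb{R}\to\mathbb{R}$ satisfy $\phi\in AC_{\rm loc}(\mathbb{R})\cap L^\infty(\mathbb{R})\cap L^1(\mathbb{R})$, $\phi'\in L^\infty(\mathbb{R})$, $\theta\in AC_{\rm loc}(\mathbb{R})\cap L^\infty(\mathbb{R})$, $\theta'\in L^\infty(\mathbb{R})\cap L^1(\mathbb{R})$, $\lim_{t\to\infty}\theta(t)=1$, $\lim_{t\to-\infty}\theta(t)=0$. In $L^2(\mathbb{R}^2)=L^2(\mathbb{R}^2;dt\,dx)$ let $A_-=-i\,\partial/\partial x$ (on its maximal domain, that is, with the weak derivative), let $B$ and $B'$ be the operators of multiplication by $\theta(t)\phi(x)$ and $\theta'(t)\phi(x)$, let $A=A_-+B$, $D_A=\partial/\partial t+A$ with $\operatorname{dom}(D_A)=W^{1,2}(\mathbb{R}^2)$, $H_1=D_A^*D_A$, $H_2=D_AD_A^*$, and $H_0=-\partial^2/\partial t^2+A_-^2=-\Delta$ with $\operatorname{dom}(H_0)=W^{2,2}(\mathbb{R}^2)$. For $n\in\mathbb{N}=\{1,2,\dots\}$ let $\chi_n(\nu)=n(\nu^2+n^2)^{-1/2}$,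 $\nu\in\mathbb{R}$, $B_n=\chi_n(A_-)B\chi_n(A_-)$, $B_n'=\chi_n(A_-)B'\chi_n(A_-)$, and $$H_{j,n}=H_0+B_nA_-+A_-B_n+B_n^2+(-1)^jB_n',\qquad \operatorname{dom}(H_{j,n})=W^{2,2}(\mathbb{R}^2),\quad j=1,2.$$ Let $z\in\mathbb{C}\setminus[0,\infty)$. Then $z\in\rho(H_j)$ and $z,\overline z\in\rho(H_{j,n})$ for $j=1,2$ and all $n\in\mathbb{N}$, and the following assertions hold. (i) $H_{j,n}$ converges to $H_j$, $j=1,2$, in the strong resolvent sense, that is, $\operatorname{s-lim}_{n\to\infty}(H_{j,n}-z)^{-1}=(H_j-z)^{-1}$. (ii) For $j=1,2$ and $n\in\mathbb{N}$ the operator $(H_{j,n}-z)^{-1}(H_0-z)$, defined on $\operatorname{dom}(H_0)$, is closable and $$\overline{(H_{j,n}-z)^{-1}(H_0-z)}=\big[(H_0-\overline z)(H_{j,n}-\overline z)^{-1}\big]^*.$$ These closures and the operators $(H_0-z)(H_{j,n}-z)^{-1}$ are bounded operators on all of $L^2(\mathbb{R}^2)$, uniformly in $n$: there is $C\in(0,\infty)$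 (which may depend on $\phi,\theta,z$) such that the norms of all of them are at most $C$ for $j=1,2$ and all $n\in\mathbb{N}$. In addition, $(H_j-z)^{-1}(H_0-z)$ is closable, its closure and $(H_0-z)(H_j-z)^{-1}$ are bounded operators on all of $L^2(\mathbb{R}^2)$, and for $j=1,2$, $$\operatorname{s-lim}_{n\to\infty}\overline{(H_{j,n}-z)^{-1}(H_0-z)}=\overline{(H_j-z)^{-1}(H_0-z)},\qquad \operatorname{s-lim}_{n\to\infty}(H_0-z)(H_{j,n}-z)^{-1}=(H_0-z)(H_j-z)^{-1}.$$ -/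

import Mathlib

open MeasureTheory Filter Topology
open scoped ENNReal SchwartzMap FourierTransform LineDeriv ComplexConjugate LinearPMap

namespace ModelOperator

noncomputable section

/-! ### Unbounded operators -/

section Abstract

variable {E : Type*} [NormedAddCommGroup E] [NormedSpace ℂ E]

/-- The product `T S` of two unbounded operators on its natural domain
`{f ∈ dom S | S f ∈ dom T}`. -/
def opProd (T S : E →ₗ.[ℂ] E) : E →ₗ.[ℂ] E where
  domain := (T.domain.comap S.toFun).map S.domain.subtype
  toFun :=
    { toFun := fun f =>
        T ⟨S ⟨f.1, by obtain ⟨g, -, hg⟩ := f.2; rw [← hg]; exact g.2⟩, by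
          obtain ⟨f, g, hg, rfl⟩ := f; exact hg⟩
      map_add' := by
        intro f g
        rw [← LinearPMap.map_add]
        congr 1
        ext1
        exact S.map_add ⟨f.1, _⟩ ⟨g.1, _⟩
      map_smul' := by
        intro c f
        rw [RingHom.id_apply, ← LinearPMap.map_smul]
        congr 1
        ext1
        exact S.map_smul c ⟨f.1, _⟩ }

theorem mem_opProd_domain (T S : E →ₗ.[ℂ] E) (f : E) :
    f ∈ (opProd T S).domain ↔ ∃ hf : f ∈ S.domain, S ⟨f, hf⟩ ∈ T.domain := by
  constructor
  · rintro ⟨g, hg, rfl⟩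
    exact ⟨g.2, hg⟩
  · rintro ⟨hf, h⟩
    exact ⟨⟨f, hf⟩, h, rfl⟩

theorem opProd_apply (T S : E →ₗ.[ℂ] E) (f : E) (hf : f ∈ S.domain) (h : S ⟨f, hf⟩ ∈ T.domain) :
    opProd T S ⟨f, (mem_opProd_domain T S f).2 ⟨hf, h⟩⟩ = T ⟨S ⟨f, hf⟩, h⟩ := rfl

/-- The operator `T - z I` on `dom T`. -/
def subScalar (T : E →ₗ.[ℂ] E) (z : ℂ) : E →ₗ.[ℂ] E where
  domain := T.domain
  toFun := T.toFun - z • T.domain.subtype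

/-- A bounded operator, viewed as an (everywhere defined) unbounded one. -/
def ofBounded (K : E →L[ℂ] E) : E →ₗ.[ℂ] E := (K : E →ₗ[ℂ] E).toPMap ⊤

/-- `R` is the bounded, everywhere defined two-sided inverse of `T - z I : dom T → E`. -/
def IsResolventAt (T : E →ₗ.[ℂ] E) (z : ℂ) (R : E →L[ℂ] E) : Prop :=
  (∀ f : E, ∃ h : R f ∈ (subScalar T z).domain, subScalar T z ⟨R f, h⟩ = f) ∧
    ∀ u : (subScalar T z).domain, R (subScalar T z u) = u

theorem IsResolventAt.unique {T : E →ₗ.[ℂ] E} {z : ℂ} {R R' : E →L[ℂ] E}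
    (h : IsResolventAt T z R) (h' : IsResolventAt T z R') : R = R' := by
  ext f
  obtain ⟨hf, hf'⟩ := h.1 f
  have := h'.2 ⟨R f, hf⟩
  rw [hf'] at this
  exact this.symm

/-- The resolvent set `ρ(T)`. -/
def resSet (T : E →ₗ.[ℂ] E) : Set ℂ := {z | ∃ R : E →L[ℂ] E, IsResolventAt T z R}

open Classical in
/-- The resolvent `(T - z I)⁻¹` for `z ∈ ρ(T)` (and `0` for other `z`). -/
def res (T : E →ₗ.[ℂ] E) (z : ℂ) : E →L[ℂ] E :=
  if h : ∃ R : E →L[ℂ] E, IsResolventAt T z R then h.choose else 0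

theorem isResolventAt_res {T : E →ₗ.[ℂ] E} {z : ℂ} (h : z ∈ resSet T) :
    IsResolventAt T z (res T z) := by
  have h' : ∃ R : E →L[ℂ] E, IsResolventAt T z R := h
  rw [res, dif_pos h']
  exact h'.choose_spec

end Abstract

/-! ### Operators in `L²(ℝ²; dt dx)` -/

/-- The plane; the coordinates of `p` are `t = p 0` and `x = p 1`. -/
abbrev Plane := EuclideanSpace ℝ (Fin 2)

/-- The Hilbert space `L²(ℝ²; dt dx)`. -/
abbrev L2 := Lp ℂ 2 (volume : Measure Plane)

/-- The embedding of `L²(ℝ²)` into the tempered distributions. -/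
def toDistr : L2 →ₗ[ℂ] 𝓢'(Plane, ℂ) :=
  (Lp.toTemperedDistributionCLM ℂ (volume : Measure Plane) 2 : L2 →L[ℂ] 𝓢'(Plane, ℂ))

theorem toDistr_injective : Function.Injective toDistr :=
  LinearMap.ker_eq_bot.1 Lp.ker_toTemperedDistributionCLM_eq_bot

/-- The distributional partial derivative `∂/∂p_i`, as a linear map on tempered distributions. -/
def distrDeriv (i : Fin 2) : 𝓢'(Plane, ℂ) →ₗ[ℂ] 𝓢'(Plane, ℂ) :=
  (LineDeriv.lineDerivOpCLM ℂ 𝓢'(Plane, ℂ) (EuclideanSpace.single i (1 : ℝ)) :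
    𝓢'(Plane, ℂ) →L[ℂ] 𝓢'(Plane, ℂ))

/-- The weak partial derivative `∂/∂p_i` in `L²(ℝ²)`, on the domain of all `f ∈ L²(ℝ²)` whose
distributional derivative `∂f/∂p_i` belongs to `L²(ℝ²)`. -/
def weakDeriv (i : Fin 2) : L2 →ₗ.[ℂ] L2 where
  domain := (LinearMap.range toDistr).comap (distrDeriv i ∘ₗ toDistr)
  toFun := (LinearEquiv.ofInjective toDistr toDistr_injective).symm.toLinearMap ∘ₗ
    (distrDeriv i ∘ₗ toDistr).restrict fun _ hf => hf

theorem weakDeriv_graph (i : Fin 2) (f g : L2) :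
    (f, g) ∈ (weakDeriv i).graph ↔
      ∂_{EuclideanSpace.single i (1 : ℝ)} (f : 𝓢'(Plane, ℂ)) = (g : 𝓢'(Plane, ℂ)) := by
  have key : ∀ u : (weakDeriv i).domain, toDistr (weakDeriv i u) = distrDeriv i (toDistr u) := by
    intro u
    exact congrArg Subtype.val ((LinearEquiv.ofInjective toDistr toDistr_injective).apply_symm_apply
      ((distrDeriv i ∘ₗ toDistr).restrict (fun _ hf => hf) u))
  rw [LinearPMap.mem_graph_iff]
  constructor
  · rintro ⟨u, rfl, rfl⟩
    exact (key u).symm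
  · intro h
    have h' : distrDeriv i (toDistr f) = toDistr g := h
    refine ⟨⟨f, ⟨g, h'.symm⟩⟩, rfl, toDistr_injective ?_⟩
    rw [key]
    exact h'

/-- The weak derivative through integration by parts against Schwartz functions. -/
theorem weakDeriv_graph_iff_integral (i : Fin 2) (f g : L2) :
    (f, g) ∈ (weakDeriv i).graph ↔ ∀ ψ : 𝓢(Plane, ℂ),
      ∫ p, fderiv ℝ ψ p (EuclideanSpace.single i (1 : ℝ)) * f p = -∫ p, ψ p * g p := by
  rw [weakDeriv_graph]
  constructor
  · intro h ψ
    have := DFunLike.congr_fun h ψ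
    simp only [TemperedDistribution.lineDerivOp_apply_apply, map_neg,
      Lp.toTemperedDistribution_apply, smul_eq_mul, SchwartzMap.lineDerivOp_apply_eq_fderiv] at this
    rw [← this, neg_neg]
  · intro h
    ext ψ
    simp only [TemperedDistribution.lineDerivOp_apply_apply, map_neg,
      Lp.toTemperedDistribution_apply, smul_eq_mul, SchwartzMap.lineDerivOp_apply_eq_fderiv]
    rw [h, neg_neg]

theorem mul_add_ae (m : Plane → ℂ) (f g : L2) :
    (fun p => m p * (f + g : L2) p) =ᵐ[volume] (fun p => m p * f p) + fun p => m p * g p := by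
  filter_upwards [Lp.coeFn_add f g] with p hp
  rw [hp, Pi.add_apply, Pi.add_apply, mul_add]

theorem mul_smul_ae (m : Plane → ℂ) (c : ℂ) (f : L2) :
    (fun p => m p * (c • f : L2) p) =ᵐ[volume] c • fun p => m p * f p := by
  filter_upwards [Lp.coeFn_smul c f] with p hp
  rw [hp, Pi.smul_apply, Pi.smul_apply, smul_eq_mul, smul_eq_mul, mul_left_comm]

theorem mul_zero_ae (m : Plane → ℂ) :
    (fun p => m p * (0 : L2) p) =ᵐ[volume] fun _ => (0 : ℂ) := by
  filter_upwards [Lp.coeFn_zero ℂ 2 (volume : Measure Plane)] with p hp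
  rw [hp, Pi.zero_apply, mul_zero]

/-- The maximal domain of multiplication by `m`: all `f ∈ L²(ℝ²)` with `m f ∈ L²(ℝ²)`. -/
def multDomain (m : Plane → ℂ) : Submodule ℂ L2 where
  carrier := {f | MemLp (fun p => m p * f p) 2 (volume : Measure Plane)}
  zero_mem' := (memLp_congr_ae (mul_zero_ae m)).2 MemLp.zero
  add_mem' := fun {f g} hf hg => (memLp_congr_ae (mul_add_ae m f g)).2 (MemLp.add hf hg)
  smul_mem' := fun c f hf => (memLp_congr_ae (mul_smul_ae m c f)).2 (MemLp.const_smul hf c)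

theorem mul_toLp_add (m : Plane → ℂ) (f g : L2)
    (hf : MemLp (fun p => m p * f p) 2 (volume : Measure Plane))
    (hg : MemLp (fun p => m p * g p) 2 (volume : Measure Plane))
    (hfg : MemLp (fun p => m p * (f + g : L2) p) 2 (volume : Measure Plane)) :
    hfg.toLp = hf.toLp + hg.toLp := by
  apply Lp.ext
  filter_upwards [hf.coeFn_toLp, hg.coeFn_toLp, hfg.coeFn_toLp, mul_add_ae m f g,
    Lp.coeFn_add hf.toLp hg.toLp] with p h1 h2 h3 h4 h5
  rw [h3, h4, h5, Pi.add_apply, Pi.add_apply, h1, h2]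

theorem mul_toLp_smul (m : Plane → ℂ) (c : ℂ) (f : L2)
    (hf : MemLp (fun p => m p * f p) 2 (volume : Measure Plane))
    (hcf : MemLp (fun p => m p * (c • f : L2) p) 2 (volume : Measure Plane)) :
    hcf.toLp = c • hf.toLp := by
  apply Lp.ext
  filter_upwards [hf.coeFn_toLp, hcf.coeFn_toLp, mul_smul_ae m c f,
    Lp.coeFn_smul c hf.toLp] with p h1 h2 h3 h4
  rw [h2, h3, h4, Pi.smul_apply, Pi.smul_apply, h1]

/-- The maximal operator of multiplication by the function `m` in `L²(ℝ²)`. -/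
def multOp (m : Plane → ℂ) : L2 →ₗ.[ℂ] L2 where
  domain := multDomain m
  toFun :=
    { toFun := fun f => MemLp.toLp (fun p => m p * f.1 p) f.2
      map_add' := fun f g => mul_toLp_add m f.1 g.1 f.2 g.2 (f + g).2
      map_smul' := fun c f => mul_toLp_smul m c f.1 f.2 (c • f).2 }

theorem coeFn_multOp (m : Plane → ℂ) (f : (multOp m).domain) :
    (multOp m f : Plane → ℂ) =ᵐ[volume] fun p => m p * f.1 p :=
  MemLp.coeFn_toLp f.2

/-- The Fourier transform on `L²(ℝ²)`, normalized by `(𝓕 f)(ξ) = ∫ e^{-2πi⟨p,ξ⟩} f(p) dp`. -/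
def fourierOp : L2 →L[ℂ] L2 :=
  (Lp.fourierTransformₗᵢ Plane ℂ).toContinuousLinearEquiv.toContinuousLinearMap

/-- The inverse Fourier transform on `L²(ℝ²)`. -/
def fourierInvOp : L2 →L[ℂ] L2 :=
  (Lp.fourierTransformₗᵢ Plane ℂ).symm.toContinuousLinearEquiv.toContinuousLinearMap

/-! ### The model -/

/-- The assumptions on the real-valued functions `φ` and `θ`. -/
structure Admissible (φ θ : ℝ → ℝ) : Prop where
  phi_ac : ∀ a b : ℝ, AbsolutelyContinuousOnInterval φ a b
  phi_bdd : MemLp φ ∞ volume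
  phi_int : MemLp φ 1 volume
  phi_deriv_bdd : MemLp (deriv φ) ∞ volume
  theta_ac : ∀ a b : ℝ, AbsolutelyContinuousOnInterval θ a b
  theta_bdd : MemLp θ ∞ volume
  theta_deriv_bdd : MemLp (deriv θ) ∞ volume
  theta_deriv_int : MemLp (deriv θ) 1 volume
  theta_top : Tendsto θ atTop (𝓝 1)
  theta_bot : Tendsto θ atBot (𝓝 0)

/-- `d/dt` in `L²(ℝ²)`. -/
def ddt : L2 →ₗ.[ℂ] L2 := weakDeriv 0

/-- `A₋ = -i d/dx` in `L²(ℝ²)`. -/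
def Aminus : L2 →ₗ.[ℂ] L2 := (-Complex.I) • weakDeriv 1

/-- `B`, multiplication by `θ(t) φ(x)`. -/
def B (φ θ : ℝ → ℝ) : L2 →ₗ.[ℂ] L2 := multOp fun p => ((θ (p 0) * φ (p 1) : ℝ) : ℂ)

/-- `B'`, multiplication by `θ'(t) φ(x)`. -/
def B' (φ θ : ℝ → ℝ) : L2 →ₗ.[ℂ] L2 := multOp fun p => ((deriv θ (p 0) * φ (p 1) : ℝ) : ℂ)

/-- `A = A₋ + B`. -/
def A (φ θ : ℝ → ℝ) : L2 →ₗ.[ℂ] L2 := Aminus + B φ θ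

/-- `D_A = d/dt + A`. For admissible `φ, θ` (where `B` is bounded) its domain is
`{f ∈ L² | ∂f/∂t, ∂f/∂x ∈ L²} = W^{1,2}(ℝ²)`. -/
def DA (φ θ : ℝ → ℝ) : L2 →ₗ.[ℂ] L2 := ddt + A φ θ

/-- `H₁ = D_A^* D_A` (for `j = 1`) and `H₂ = D_A D_A^*` (for `j = 2`). -/
def H (φ θ : ℝ → ℝ) (j : ℕ) : L2 →ₗ.[ℂ] L2 :=
  if j = 1 then opProd (DA φ θ)† (DA φ θ) else opProd (DA φ θ) (DA φ θ)†

/-- The Sobolev space `W^{2,2}(ℝ²)`: all weak partial derivatives of order at most two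
belong to `L²(ℝ²)`. -/
def W22 : Submodule ℂ L2 := ⨅ i : Fin 2, ⨅ k : Fin 2, (opProd (weakDeriv i) (weakDeriv k)).domain

/-- `H₀ = -d²/dt² + A₋² = -Δ` with domain `W^{2,2}(ℝ²)`. -/
def H0 : L2 →ₗ.[ℂ] L2 := (-opProd ddt ddt + opProd Aminus Aminus).domRestrict W22

theorem H0_domain : H0.domain = W22 := by
  refine le_antisymm inf_le_left (le_inf le_rfl fun f hf => ?_)
  simp only [W22, Submodule.mem_iInf] at hf
  refine ⟨hf 0 0, (mem_opProd_domain _ _ _).2 ?_⟩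
  obtain ⟨h, h'⟩ := (mem_opProd_domain _ _ _).1 (hf 1 1)
  exact ⟨h, Submodule.smul_mem _ (-Complex.I) h'⟩

/-- The function `χ_n(ν) = n / (ν² + n²)^{1/2}`. -/
def chi (n : ℕ) (ν : ℝ) : ℝ := n / Real.sqrt (ν ^ 2 + (n : ℝ) ^ 2)

/-- `χ_n(A₋)`. The operator `A₋ = -i d/dx` is unitarily equivalent, through the Fourier transform
normalized as above, to multiplication by `2πξ₁`, where `ξ₁` is the variable dual to `x`. -/
def chiA (n : ℕ) : L2 →ₗ.[ℂ] L2 :=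
  opProd (ofBounded fourierInvOp)
    (opProd (multOp fun ξ => ((chi n (2 * Real.pi * ξ 1) : ℝ) : ℂ)) (ofBounded fourierOp))

/-- `B_n = χ_n(A₋) B χ_n(A₋)`. -/
def Bn (φ θ : ℝ → ℝ) (n : ℕ) : L2 →ₗ.[ℂ] L2 := opProd (chiA n) (opProd (B φ θ) (chiA n))

/-- `B_n' = χ_n(A₋) B' χ_n(A₋)`. -/
def Bn' (φ θ : ℝ → ℝ) (n : ℕ) : L2 →ₗ.[ℂ] L2 := opProd (chiA n) (opProd (B' φ θ) (chiA n))

/-- `H_{j,n} = H₀ + B_n A₋ + A₋ B_n + B_n² + (-1)^j B_n'`, on `dom(H₀) = W^{2,2}(ℝ²)`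
(for admissible `φ, θ` and `n ≥ 1` the other summands are defined on all of `dom(H₀)`). -/
def Hn (φ θ : ℝ → ℝ) (j n : ℕ) : L2 →ₗ.[ℂ] L2 :=
  H0 + opProd (Bn φ θ n) Aminus + opProd Aminus (Bn φ θ n) + opProd (Bn φ θ n) (Bn φ θ n)
    + ((-1 : ℂ) ^ j) • Bn' φ θ n

/-- `(H₀ - z) (T - z)⁻¹`, for `z ∈ ρ(T)`. -/
def leftProd (T : L2 →ₗ.[ℂ] L2) (z : ℂ) : L2 →ₗ.[ℂ] L2 :=
  opProd (subScalar H0 z) (ofBounded (res T z))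

/-- `(T - z)⁻¹ (H₀ - z)` on `dom(H₀)`, for `z ∈ ρ(T)`. -/
def rightProd (T : L2 →ₗ.[ℂ] L2) (z : ℂ) : L2 →ₗ.[ℂ] L2 :=
  opProd (ofBounded (res T z)) (subScalar H0 z)

end

end ModelOperator

open ModelOperator

/-! Everything reduces to one abstract situation, uniform in n. Put R = (H₀ + k²)⁻¹. On W^{2,2} each
H_{j,n} equals H₀ + W_n (H₀ + k²) with W_n = (B_n A₋ + A₋ B_n + B_n² ± B_n') R, and H_j has the same
form with W built from B and B'. Since A₋ B = B A₋ + C, where C is multiplication by -i θ(t) φ'(x),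
and since ‖R‖ and ‖A₋ R‖ are at most 1/k, the norm of W is O(1/k). The operators χ_n(A₋) are
contractions commuting with ∂ₜ and A₋, so sandwiching preserves the commutator relations and does
not increase the norms of B, B', C. One large k thus gives ‖W‖, ‖W_n‖ ≤ 1/2 for all n and both j
(`norm_pertOp_le`).

Each such operator T factors as D_{-ε} D_ε with D_ε = ε ∂ₜ + A₋ + b and ε = ±1, where D_{-ε} is
formally adjoint to D_ε; hence T ≥ 0 (`IsSmooth.isRelPerturbation`). For H_j one also needs that the
domain of the product D_A^* D_A or D_A D_A^* is exactly W^{2,2}, which is elliptic regularity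
(`IsSmooth.mem_range_freeRes`) together with the identification of D_A^*
(`exists_of_forall_inner_eq`).

Now (T + κ)⁻¹ = R (1 + W)⁻¹ with κ = k², and T ≥ 0 makes Q = 1 - (z + κ)(T + κ)⁻¹ invertible with a
bound depending only on z and κ. So (T - z)⁻¹ = R (1 + W)⁻¹ Q⁻¹ and (H₀ - z)(T - z)⁻¹ = (1 - (z + κ)
R)(1 + W)⁻¹ Q⁻¹ is bounded uniformly in n. The closure of (T - z)⁻¹ (H₀ - z) is the adjoint of the
latter operator taken at the conjugate of z.

Strong convergence W_n → W passes through inverses and products thanks to the uniform bounds.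
Adjoints need W_n^* → W^* strongly, which follows from the intertwining relation W^* R = R W
(`IsRelPerturbation.star_mul_eq`) and the density of the range of R. -/

namespace ModelOperator

noncomputable section

/-! ### Graphs of the basic constructions -/

section Graphs

variable {E : Type*} [NormedAddCommGroup E] [NormedSpace ℂ E]

/-- Unbounded operators are handled through their graphs: a pair in a graph carries the domain
condition and the value at once, so no elements of domain subtypes have to be transported. -/
theorem mem_graph_opProd {T S : E →ₗ.[ℂ] E} {f g : E} :
    (f, g) ∈ (opProd T S).graph ↔ ∃ h, (f, h) ∈ S.graph ∧ (h, g) ∈ T.graph := by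
  constructor
  · intro h
    obtain ⟨⟨u, hu⟩, rfl, rfl⟩ := (LinearPMap.mem_graph_iff _).1 h
    obtain ⟨hu', h'⟩ := (mem_opProd_domain T S u).1 hu
    refine ⟨S ⟨u, hu'⟩, S.mem_graph ⟨u, hu'⟩, ?_⟩
    rw [opProd_apply T S u hu' h']
    exact T.mem_graph ⟨_, h'⟩
  · rintro ⟨h, h1, h2⟩
    obtain ⟨⟨u, hu⟩, rfl, rfl⟩ := (LinearPMap.mem_graph_iff _).1 h1
    obtain ⟨⟨v, hv⟩, h3, rfl⟩ := (LinearPMap.mem_graph_iff _).1 h2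
    obtain rfl : v = S ⟨u, hu⟩ := h3
    rw [← opProd_apply T S u hu hv]
    exact (opProd T S).mem_graph ⟨u, _⟩

theorem mem_graph_add {T S : E →ₗ.[ℂ] E} {f g : E} :
    (f, g) ∈ (T + S).graph ↔ ∃ g₁ g₂, (f, g₁) ∈ T.graph ∧ (f, g₂) ∈ S.graph ∧ g = g₁ + g₂ := by
  constructor
  · intro h
    obtain ⟨⟨u, hu⟩, rfl, rfl⟩ := (LinearPMap.mem_graph_iff _).1 h
    exact ⟨T ⟨u, hu.1⟩, S ⟨u, hu.2⟩, T.mem_graph ⟨u, hu.1⟩, S.mem_graph ⟨u, hu.2⟩, rfl⟩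
  · rintro ⟨g₁, g₂, h1, h2, rfl⟩
    obtain ⟨⟨u, hu⟩, rfl, rfl⟩ := (LinearPMap.mem_graph_iff _).1 h1
    obtain ⟨⟨v, hv⟩, h3, rfl⟩ := (LinearPMap.mem_graph_iff _).1 h2
    obtain rfl : v = u := h3
    exact (T + S).mem_graph ⟨v, hu, hv⟩

theorem mem_graph_smul {T : E →ₗ.[ℂ] E} {c : ℂ} {f g : E} :
    (f, g) ∈ (c • T).graph ↔ ∃ g', (f, g') ∈ T.graph ∧ g = c • g' := by
  constructor
  · intro h
    obtain ⟨u, rfl, rfl⟩ := (LinearPMap.mem_graph_iff _).1 h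
    exact ⟨T u, T.mem_graph u, rfl⟩
  · rintro ⟨g', h, rfl⟩
    obtain ⟨u, rfl, rfl⟩ := (LinearPMap.mem_graph_iff _).1 h
    exact (c • T).mem_graph u

theorem mem_graph_neg {T : E →ₗ.[ℂ] E} {f g : E} :
    (f, g) ∈ (-T).graph ↔ (f, -g) ∈ T.graph := by
  constructor
  · intro h
    obtain ⟨u, rfl, rfl⟩ := (LinearPMap.mem_graph_iff _).1 h
    simp only [LinearPMap.neg_apply, neg_neg]
    exact T.mem_graph u
  · intro h
    obtain ⟨u, rfl, h'⟩ := (LinearPMap.mem_graph_iff _).1 h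
    obtain rfl : g = -T u := by rw [h', neg_neg]
    exact (-T).mem_graph u

theorem mem_graph_ofBounded {K : E →L[ℂ] E} {f g : E} :
    (f, g) ∈ (ofBounded K).graph ↔ g = K f := by
  constructor
  · intro h
    obtain ⟨u, rfl, rfl⟩ := (LinearPMap.mem_graph_iff _).1 h
    rfl
  · rintro rfl
    exact (ofBounded K).mem_graph ⟨f, trivial⟩

theorem mem_graph_subScalar {T : E →ₗ.[ℂ] E} {z : ℂ} {f g : E} :
    (f, g) ∈ (subScalar T z).graph ↔ (f, g + z • f) ∈ T.graph := by
  constructor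
  · intro h
    obtain ⟨u, rfl, rfl⟩ := (LinearPMap.mem_graph_iff _).1 h
    have h1 : subScalar T z u = T u - z • (u : E) := rfl
    rw [h1, sub_add_cancel]
    exact T.mem_graph u
  · intro h
    obtain ⟨u, rfl, h'⟩ := (LinearPMap.mem_graph_iff _).1 h
    have h1 : subScalar T z u = T u - z • (u : E) := rfl
    obtain rfl : g = subScalar T z u := by rw [h1]; exact eq_sub_of_add_eq h'.symm
    exact (subScalar T z).mem_graph u

theorem graph_unique {T : E →ₗ.[ℂ] E} {f g g' : E} (h : (f, g) ∈ T.graph) (h' : (f, g') ∈ T.graph) :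
    g = g' :=
  T.mem_graph_snd_inj h h' rfl

theorem eq_of_mem_graph_iff {T S : E →ₗ.[ℂ] E}
    (h : ∀ f g, (f, g) ∈ T.graph ↔ (f, g) ∈ S.graph) : T = S :=
  LinearPMap.eq_of_eq_graph (Submodule.ext fun p => h p.1 p.2)

theorem isResolventAt_iff {T : E →ₗ.[ℂ] E} {z : ℂ} {R : E →L[ℂ] E} :
    IsResolventAt T z R ↔ (∀ f, (R f, f + z • R f) ∈ T.graph) ∧
      ∀ u v, (u, v) ∈ T.graph → R (v - z • u) = u := by
  refine and_congr (forall_congr' fun f => ?_) ⟨fun h u v huv => ?_, fun h u => ?_⟩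
  · rw [← mem_graph_subScalar, LinearPMap.mem_graph_iff]
    constructor
    · rintro ⟨h, h'⟩
      exact ⟨⟨R f, h⟩, rfl, h'⟩
    · rintro ⟨u, h, h'⟩
      obtain ⟨u, hu⟩ := u
      obtain rfl : u = R f := h
      exact ⟨hu, h'⟩
  · have : (u, v - z • u) ∈ (subScalar T z).graph := by
      rw [mem_graph_subScalar, sub_add_cancel]; exact huv
    obtain ⟨w, rfl, hw⟩ := (LinearPMap.mem_graph_iff _).1 this
    simp only at hw
    rw [← hw]
    exact h w
  · have := (subScalar T z).mem_graph u
    rw [mem_graph_subScalar] at this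
    simpa using h _ _ this

theorem IsResolventAt.res_eq {T : E →ₗ.[ℂ] E} {z : ℂ} {R : E →L[ℂ] E} (h : IsResolventAt T z R) :
    res T z = R :=
  (isResolventAt_res ⟨R, h⟩).unique h

theorem isClosed_ofBounded (K : E →L[ℂ] E) : (ofBounded K).IsClosed := by
  have : ((ofBounded K).graph : Set (E × E)) = {p | p.2 = K p.1} := by
    ext ⟨f, g⟩
    exact mem_graph_ofBounded
  rw [LinearPMap.IsClosed, this]
  exact isClosed_eq continuous_snd (K.continuous.comp continuous_fst)

/-- A densely defined restriction of a bounded operator is closable, and the bounded operator is its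
closure. -/
theorem isClosable_and_closure_eq_ofBounded {T : E →ₗ.[ℂ] E} {K : E →L[ℂ] E}
    (hT : Dense (T.domain : Set E)) (hK : ∀ u v, (u, v) ∈ T.graph → v = K u) :
    T.IsClosable ∧ T.closure = ofBounded K := by
  have hle : T ≤ ofBounded K :=
    LinearPMap.le_of_le_graph fun ⟨u, v⟩ h => mem_graph_ofBounded.2 (hK u v h)
  have hcl : T.IsClosable := (isClosed_ofBounded K).isClosable.leIsClosable hle
  refine ⟨hcl, LinearPMap.eq_of_eq_graph ?_⟩
  rw [← hcl.graph_closure_eq_closure_graph]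
  apply le_antisymm
  · rw [← (isClosed_ofBounded K).submodule_topologicalClosure_eq]
    exact Submodule.topologicalClosure_mono (LinearPMap.le_graph_of_le hle)
  · rintro ⟨f, g⟩ h
    obtain rfl := mem_graph_ofBounded.1 h
    -- The continuous map u ↦ (u, K u) sends the dense domain into the graph of T, hence sends every
    -- vector into the closure of that graph.
    have hmap : Set.MapsTo (fun u : E => (u, K u)) (T.domain : Set E) (T.graph : Set (E × E)) := by
      intro u hu
      have := T.mem_graph ⟨u, hu⟩
      rwa [hK _ _ this] at this
    exact hmap.closure (continuous_id.prodMk K.continuous) (hT f)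

end Graphs

/-! ### Graphs of adjoints -/

section Adjoint

variable {E : Type*} [NormedAddCommGroup E] [InnerProductSpace ℂ E] [CompleteSpace E]

theorem mem_graph_adjoint {T : E →ₗ.[ℂ] E} (hT : Dense (T.domain : Set E)) {f g : E} :
    (f, g) ∈ (T†).graph ↔ ∀ u v, (u, v) ∈ T.graph → inner ℂ g u = inner ℂ f v := by
  constructor
  · intro h u v huv
    obtain ⟨f, rfl, rfl⟩ := (LinearPMap.mem_graph_iff _).1 h
    obtain ⟨u, rfl, rfl⟩ := (LinearPMap.mem_graph_iff _).1 huv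
    exact T.adjoint_isFormalAdjoint hT f u
  · intro h
    have h' : ∀ u : T.domain, inner ℂ g (u : E) = inner ℂ f (T u) := fun u => h _ _ (T.mem_graph u)
    have hf : f ∈ (T†).domain := LinearPMap.mem_adjoint_domain_of_exists _ ⟨g, h'⟩
    have := LinearPMap.adjoint_apply_eq hT ⟨f, hf⟩ h'
    rw [← this]
    exact (T†).mem_graph ⟨f, hf⟩

theorem adjoint_ofBounded (K : E →L[ℂ] E) : (ofBounded K)† = ofBounded (star K) :=
  K.toPMap_adjoint_eq_adjoint_toPMap_of_dense (by simp)

end Adjoint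

/-! ### Bounded operators: inverses and strong convergence -/

section Bounded

variable {E : Type*} [NormedAddCommGroup E] [NormedSpace ℂ E]

theorem inverse_mul_apply {Q : E →L[ℂ] E} (hQ : IsUnit Q) (f : E) : Ring.inverse Q (Q f) = f :=
  DFunLike.congr_fun (Ring.inverse_mul_cancel Q hQ) f

theorem mul_inverse_apply {Q : E →L[ℂ] E} (hQ : IsUnit Q) (f : E) : Q (Ring.inverse Q f) = f :=
  DFunLike.congr_fun (Ring.mul_inverse_cancel Q hQ) f

theorem norm_inverse_le {Q : E →L[ℂ] E} (hQ : IsUnit Q) {c : ℝ} (hc : 0 ≤ c)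
    (h : ∀ f, ‖f‖ ≤ c * ‖Q f‖) : ‖Ring.inverse Q‖ ≤ c :=
  ContinuousLinearMap.opNorm_le_bound _ hc fun f => by
    simpa only [mul_inverse_apply hQ] using h (Ring.inverse Q f)

/-- A uniform bound makes strong convergence joint in the operator and the vector. This is how
products of strongly convergent sequences pass to the limit. -/
theorem tendsto_apply_of_tendsto {K : ℕ → E →L[ℂ] E} {K' : E →L[ℂ] E} {c : ℝ}
    (hc : ∀ n, ‖K n‖ ≤ c) (h : ∀ f, Tendsto (fun n => K n f) atTop (𝓝 (K' f)))
    {u : ℕ → E} {u' : E} (hu : Tendsto u atTop (𝓝 u')) :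
    Tendsto (fun n => K n (u n)) atTop (𝓝 (K' u')) := by
  have h1 : Tendsto (fun n => K n (u n - u')) atTop (𝓝 0) := by
    have h2 : Tendsto (fun n => c * ‖u n - u'‖) atTop (𝓝 0) := by
      simpa using (tendsto_iff_norm_sub_tendsto_zero.1 hu).const_mul c
    exact squeeze_zero_norm (fun n => (K n).le_of_opNorm_le (hc n) _) h2
  simpa using h1.add (h u')

/-- Second resolvent identity: Q_n⁻¹ - Q⁻¹ = -Q_n⁻¹ (Q_n - Q) Q⁻¹, with the leftmost factor
uniformly bounded. -/
theorem tendsto_inverse {Q : ℕ → E →L[ℂ] E} {Q' : E →L[ℂ] E} {c : ℝ}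
    (hQ : ∀ n, IsUnit (Q n)) (hQ' : IsUnit Q') (hc : ∀ n, ‖Ring.inverse (Q n)‖ ≤ c)
    (h : ∀ f, Tendsto (fun n => Q n f) atTop (𝓝 (Q' f))) (f : E) :
    Tendsto (fun n => Ring.inverse (Q n) f) atTop (𝓝 (Ring.inverse Q' f)) := by
  rw [tendsto_iff_norm_sub_tendsto_zero]
  have h1 : Tendsto (fun n => c * ‖Q n (Ring.inverse Q' f) - Q' (Ring.inverse Q' f)‖) atTop (𝓝 0) := by
    simpa using (tendsto_iff_norm_sub_tendsto_zero.1 (h (Ring.inverse Q' f))).const_mul c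
  refine squeeze_zero (fun _ => norm_nonneg _) (fun n => ?_) h1
  have : Ring.inverse (Q n) f - Ring.inverse Q' f =
      -Ring.inverse (Q n) (Q n (Ring.inverse Q' f) - Q' (Ring.inverse Q' f)) := by
    rw [map_sub, inverse_mul_apply (hQ n), mul_inverse_apply hQ', neg_sub]
  rw [this, norm_neg]
  exact (Ring.inverse (Q n)).le_of_opNorm_le (hc n) _

theorem tendsto_of_tendsto_denseRange {K : ℕ → E →L[ℂ] E} {K' R : E →L[ℂ] E} {c : ℝ}
    (hR : DenseRange R) (hc : ∀ n, ‖K n‖ ≤ c)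
    (h : ∀ g, Tendsto (fun n => K n (R g)) atTop (𝓝 (K' (R g)))) (f : E) :
    Tendsto (fun n => K n f) atTop (𝓝 (K' f)) := by
  rw [Metric.tendsto_atTop]
  intro ε hε
  -- The summand 1 keeps C positive, so that ε / (2 C) is an admissible distance for the
  -- approximation by the range of R.
  set C : ℝ := |c| + ‖K'‖ + 1 with hC
  have hC0 : 0 < C := by positivity
  obtain ⟨g, hg⟩ := Metric.denseRange_iff.1 hR f (ε / (2 * C)) (by positivity)
  obtain ⟨N, hN⟩ := Metric.tendsto_atTop.1 (h g) (ε / 2) (by positivity)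
  refine ⟨N, fun n hn => ?_⟩
  have h1 := hN n hn
  rw [dist_eq_norm] at h1 hg ⊢
  have e : K n f - K' f = K n (f - R g) + (K n (R g) - K' (R g)) - K' (f - R g) := by
    simp only [map_sub]; abel
  have h2 : ‖K n (f - R g)‖ ≤ |c| * ‖f - R g‖ :=
    (K n).le_of_opNorm_le ((hc n).trans (le_abs_self c)) _
  have h3 : ‖K' (f - R g)‖ ≤ ‖K'‖ * ‖f - R g‖ := K'.le_opNorm _
  have h4 : C * ‖f - R g‖ < ε / 2 := by
    calc C * ‖f - R g‖ < C * (ε / (2 * C)) := by gcongr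
      _ = ε / 2 := by field_simp
  have h5 : ‖K n f - K' f‖ ≤ ‖K n (f - R g)‖ + ‖K n (R g) - K' (R g)‖ + ‖K' (f - R g)‖ := by
    rw [e]
    exact (norm_sub_le _ _).trans (by gcongr; exact norm_add_le _ _)
  nlinarith [norm_nonneg (f - R g)]

theorem norm_le_of_norm_sub_half {W : E →L[ℂ] E} (hW : ‖W‖ ≤ 1 / 2) (f : E) :
    ‖f‖ ≤ 2 * ‖(1 + W) f‖ := by
  have h1 : ‖W f‖ ≤ 1 / 2 * ‖f‖ := W.le_of_opNorm_le hW f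
  have h2 : ‖f‖ ≤ ‖(1 + W) f‖ + ‖W f‖ := by
    calc ‖f‖ = ‖(1 + W) f - W f‖ := by simp
      _ ≤ _ := norm_sub_le _ _
  linarith

end Bounded

/-! ### Invertibility criteria on a Hilbert space -/

section Units

variable {E : Type*} [NormedAddCommGroup E] [InnerProductSpace ℂ E] [CompleteSpace E]

/-- The lower bound gives injectivity and closed range; the orthogonal complement of the range is
the kernel of the adjoint, so the range is also dense. -/
theorem isUnit_of_bound {Q : E →L[ℂ] E} {c : ℝ} (h : ∀ f, ‖f‖ ≤ c * ‖Q f‖)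
    (h' : ∀ f, star Q f = 0 → f = 0) : IsUnit Q := by
  have hanti : AntilipschitzWith (Real.toNNReal c) Q :=
    Q.antilipschitz_of_bound fun f => (h f).trans
      (mul_le_mul_of_nonneg_right (Real.le_coe_toNNReal c) (norm_nonneg _))
  rw [ContinuousLinearMap.isUnit_iff_bijective,
    ContinuousLinearMap.bijective_iff_dense_range_and_antilipschitz]
  refine ⟨?_, _, hanti⟩
  rw [Submodule.topologicalClosure_eq_top_iff, ContinuousLinearMap.orthogonal_range,
    LinearMap.ker_eq_bot']
  exact h'

theorem isUnit_one_add {W : E →L[ℂ] E} (hW : ‖W‖ ≤ 1 / 2) : IsUnit (1 + W) := by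
  have : ‖-W‖ < 1 := by rw [norm_neg]; linarith
  simpa using (Units.oneSub (-W) this).isUnit

theorem norm_inverse_one_add_le {W : E →L[ℂ] E} (hW : ‖W‖ ≤ 1 / 2) : ‖Ring.inverse (1 + W)‖ ≤ 2 :=
  norm_inverse_le (isUnit_one_add hW) zero_le_two (norm_le_of_norm_sub_half hW)

end Units

/-! ### Nonnegative relatively bounded perturbations -/

section RelativePerturbation

variable {E : Type*} [NormedAddCommGroup E] [InnerProductSpace ℂ E] [CompleteSpace E]

/-- `R = (H + κ)⁻¹` is a self-adjoint resolvent of `H` at the point `-κ < 0`. -/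
structure IsNegResolvent (H : E →ₗ.[ℂ] E) (κ : ℝ) (R : E →L[ℂ] E) : Prop where
  graph_iff : ∀ u v, (u, v) ∈ H.graph ↔ ∃ g, u = R g ∧ v = g - (κ : ℂ) • R g
  selfAdjoint : IsSelfAdjoint R
  injective : ∀ f, R f = 0 → f = 0

/-- `T = H + W (H + κ)` on `dom H` with `‖W‖ ≤ 1/2`, and `T` is nonnegative;
here `R = (H + κ)⁻¹`. -/
structure IsRelPerturbation (T : E →ₗ.[ℂ] E) (κ : ℝ) (R W : E →L[ℂ] E) : Prop where
  graph_iff : ∀ u v, (u, v) ∈ T.graph ↔ ∃ g, u = R g ∧ v = g - (κ : ℂ) • R g + W g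
  norm_le : ‖W‖ ≤ 1 / 2
  nonneg : ∀ u v, (u, v) ∈ T.graph → ∃ a : ℝ, 0 ≤ a ∧ inner ℂ u v = (a : ℂ)

/-- `(T + κ)⁻¹` for the perturbed operator `T`. -/
def pertInv (R W : E →L[ℂ] E) : E →L[ℂ] E := R * Ring.inverse (1 + W)

/-- `1 - (z + κ) (T + κ)⁻¹ = (T - z) (T + κ)⁻¹`. -/
def shiftOp (κ : ℝ) (z : ℂ) (R W : E →L[ℂ] E) : E →L[ℂ] E := 1 - (z + κ) • pertInv R W

/-- `(T - z)⁻¹` for the perturbed operator `T`. -/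
def pertRes (κ : ℝ) (z : ℂ) (R W : E →L[ℂ] E) : E →L[ℂ] E :=
  pertInv R W * Ring.inverse (shiftOp κ z R W)

/-- `(H - z) (T - z)⁻¹` for the perturbed operator `T`. -/
def pertLeft (κ : ℝ) (z : ℂ) (R W : E →L[ℂ] E) : E →L[ℂ] E :=
  (1 - (z + κ) • R) * (Ring.inverse (1 + W) * Ring.inverse (shiftOp κ z R W))

variable {H T : E →ₗ.[ℂ] E} {κ : ℝ} {R W : E →L[ℂ] E} {z : ℂ}

theorem IsNegResolvent.denseRange (hR : IsNegResolvent H κ R) : DenseRange R := by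
  have h : R.range.topologicalClosure = ⊤ := by
    rw [Submodule.topologicalClosure_eq_top_iff, ContinuousLinearMap.orthogonal_range,
      LinearMap.ker_eq_bot']
    intro f hf
    refine hR.injective f ?_
    rw [← hR.selfAdjoint.star_eq]
    exact hf
  exact (Submodule.dense_iff_topologicalClosure_eq_top (s := R.range)).2 h

theorem IsNegResolvent.dense_domain (hR : IsNegResolvent H κ R) : Dense (H.domain : Set E) := by
  refine hR.denseRange.mono ?_
  rintro _ ⟨g, rfl⟩
  exact LinearPMap.mem_domain_of_mem_graph ((hR.graph_iff _ _).2 ⟨g, rfl, rfl⟩)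

theorem IsRelPerturbation.mem_graph (hT : IsRelPerturbation T κ R W) (f : E) :
    (pertInv R W f, f - (κ : ℂ) • pertInv R W f) ∈ T.graph := by
  refine (hT.graph_iff _ _).2 ⟨Ring.inverse (1 + W) f, rfl, ?_⟩
  have h := mul_inverse_apply (isUnit_one_add hT.norm_le) f
  have h' : Ring.inverse (1 + W) f + W (Ring.inverse (1 + W) f) = f := h
  change f - (κ : ℂ) • R (Ring.inverse (1 + W) f) = _
  nth_rewrite 1 [← h']
  abel

/-- With u = (T + κ)⁻¹ f the form ⟪u, f⟫ = ⟪u, T u⟫ + κ ‖u‖² is real, and on a complex space a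
bounded operator with real quadratic form is self-adjoint. -/
theorem IsRelPerturbation.pertInv_isSelfAdjoint (hT : IsRelPerturbation T κ R W) :
    IsSelfAdjoint (pertInv R W) := by
  rw [ContinuousLinearMap.isSelfAdjoint_iff_isSymmetric,
    LinearMap.isSymmetric_iff_inner_map_self_real]
  intro f
  obtain ⟨a, -, ha⟩ := hT.nonneg _ _ (hT.mem_graph f)
  have h : inner ℂ (pertInv R W f) f =
      ((a + κ * ‖pertInv R W f‖ ^ 2 : ℝ) : ℂ) := by
    rw [inner_sub_right, inner_smul_right, inner_self_eq_norm_sq_to_K, sub_eq_iff_eq_add] at ha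
    rw [ha]
    push_cast
    rfl
  change conj (inner ℂ (pertInv R W f) f) = inner ℂ (pertInv R W f) f
  rw [h, Complex.conj_ofReal]

/-- Homogeneous form of the positive distance from z to [0, ∞), applied with a = ⟪u, T u⟫ and s =
‖u‖². For real z < 0 the constant is -Re z, otherwise it is |Im z|. -/
theorem exists_lower_bound (hz : ¬ (z.im = 0 ∧ 0 ≤ z.re)) :
    ∃ δ : ℝ, 0 < δ ∧ ∀ a s : ℝ, 0 ≤ a → 0 ≤ s → δ * s ≤ ‖(a : ℂ) - z * s‖ := by
  by_cases him : z.im = 0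
  · have hre : z.re < 0 := by
      by_contra h
      exact hz ⟨him, not_lt.1 h⟩
    refine ⟨-z.re, by linarith, fun a s ha hs => le_trans ?_ (Complex.re_le_norm _)⟩
    simp only [Complex.sub_re, Complex.mul_re, Complex.ofReal_re, Complex.ofReal_im]
    nlinarith
  · refine ⟨|z.im|, abs_pos.2 him, fun a s _ hs => le_trans ?_ (Complex.abs_im_le_norm _)⟩
    simp [abs_mul, abs_of_nonneg hs]

/-- With u = (T + κ)⁻¹ f the shifted operator sends f to (T - z) u; pairing with u bounds ‖u‖, and f
differs from the image by (z + κ) u. The constant does not involve W, which is the source of all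
uniformity in n. -/
theorem IsRelPerturbation.norm_le_shiftOp (hT : IsRelPerturbation T κ R W) {δ : ℝ} (hδ : 0 < δ)
    (hz : ∀ a s : ℝ, 0 ≤ a → 0 ≤ s → δ * s ≤ ‖(a : ℂ) - z * s‖) (f : E) :
    ‖f‖ ≤ (1 + ‖z + κ‖ / δ) * ‖shiftOp κ z R W f‖ := by
  set u := pertInv R W f with hu
  have hQ : shiftOp κ z R W f = f - (z + κ) • u := rfl
  obtain ⟨a, ha0, ha⟩ := hT.nonneg _ _ (hT.mem_graph f)
  have h1 : inner ℂ u (shiftOp κ z R W f) = (a : ℂ) - z * (‖u‖ ^ 2 : ℝ) := by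
    have : shiftOp κ z R W f = (f - (κ : ℂ) • u) - z • u := by
      rw [hQ, add_smul]; abel
    rw [this, inner_sub_right, ha, inner_smul_right, inner_self_eq_norm_sq_to_K]
    push_cast
    rfl
  have h2 : δ * ‖u‖ ^ 2 ≤ ‖u‖ * ‖shiftOp κ z R W f‖ :=
    (hz a _ ha0 (by positivity)).trans (h1 ▸ norm_inner_le_norm _ _)
  have h3 : ‖u‖ ≤ ‖shiftOp κ z R W f‖ / δ := by
    rw [le_div_iff₀ hδ]
    rcases (norm_nonneg u).eq_or_lt with h | h
    · rw [← h, zero_mul]; exact norm_nonneg _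
    · nlinarith
  have h4 : ‖f‖ ≤ ‖shiftOp κ z R W f‖ + ‖z + κ‖ * ‖u‖ := by
    rw [← norm_smul]
    calc ‖f‖ = ‖shiftOp κ z R W f + (z + κ) • u‖ := by rw [hQ, sub_add_cancel]
      _ ≤ _ := norm_add_le _ _
  calc ‖f‖ ≤ ‖shiftOp κ z R W f‖ + ‖z + κ‖ * (‖shiftOp κ z R W f‖ / δ) := by
        exact h4.trans (by gcongr)
    _ = _ := by ring

theorem IsRelPerturbation.star_shiftOp (hT : IsRelPerturbation T κ R W) (z : ℂ) :
    star (shiftOp κ z R W) = shiftOp κ (conj z) R W := by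
  simp only [shiftOp, star_sub, star_one, star_smul, hT.pertInv_isSelfAdjoint.star_eq]
  simp

theorem not_conj_nonneg (hz : ¬ (z.im = 0 ∧ 0 ≤ z.re)) :
    ¬ ((conj z).im = 0 ∧ 0 ≤ (conj z).re) := by
  simpa using hz

/-- The adjoint is the same operator at the conjugate point, which also avoids [0, ∞); so the lower
bound holds for both and the adjoint has trivial kernel. -/
theorem IsRelPerturbation.isUnit_shiftOp (hT : IsRelPerturbation T κ R W)
    (hz : ¬ (z.im = 0 ∧ 0 ≤ z.re)) : IsUnit (shiftOp κ z R W) := by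
  obtain ⟨δ, hδ, h⟩ := exists_lower_bound hz
  obtain ⟨δ', hδ', h'⟩ := exists_lower_bound (not_conj_nonneg hz)
  refine isUnit_of_bound (hT.norm_le_shiftOp hδ h) fun f hf => ?_
  have := hT.norm_le_shiftOp hδ' h' f
  rw [← hT.star_shiftOp, hf, norm_zero, mul_zero] at this
  exact norm_le_zero_iff.1 this

theorem exists_norm_inverse_shiftOp_le (κ : ℝ) (hz : ¬ (z.im = 0 ∧ 0 ≤ z.re)) :
    ∃ c : ℝ, 0 ≤ c ∧ ∀ (T : E →ₗ.[ℂ] E) (R W : E →L[ℂ] E), IsRelPerturbation T κ R W →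
      ‖Ring.inverse (shiftOp κ z R W)‖ ≤ c := by
  obtain ⟨δ, hδ, h⟩ := exists_lower_bound hz
  exact ⟨1 + ‖z + κ‖ / δ, by positivity, fun T R W hT =>
    norm_inverse_le (hT.isUnit_shiftOp hz) (by positivity) (hT.norm_le_shiftOp hδ h)⟩

theorem IsRelPerturbation.isResolventAt (hT : IsRelPerturbation T κ R W)
    (hz : ¬ (z.im = 0 ∧ 0 ≤ z.re)) : IsResolventAt T z (pertRes κ z R W) := by
  rw [isResolventAt_iff]
  refine ⟨fun f => ?_, fun u v huv => ?_⟩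
  · convert! hT.mem_graph (Ring.inverse (shiftOp κ z R W) f) using 2
    have h := mul_inverse_apply (hT.isUnit_shiftOp hz) f
    set N := Ring.inverse (shiftOp κ z R W) f
    have h' : N - (z + κ) • pertInv R W N = f := h
    change f + z • pertInv R W N = N - (κ : ℂ) • pertInv R W N
    rw [← h', add_smul]
    abel
  · obtain ⟨g, rfl, rfl⟩ := (hT.graph_iff _ _).1 huv
    have hg : Ring.inverse (1 + W) ((1 + W) g) = g :=
      inverse_mul_apply (isUnit_one_add hT.norm_le) g
    have hu : pertInv R W ((1 + W) g) = R g := congrArg R hg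
    have h1 : g - (κ : ℂ) • R g + W g - z • R g = shiftOp κ z R W ((1 + W) g) := by
      change _ = (g + W g) - (z + κ) • pertInv R W ((1 + W) g)
      rw [hu, add_smul]
      abel
    rw [h1]
    change pertInv R W (Ring.inverse (shiftOp κ z R W) _) = _
    rw [inverse_mul_apply (hT.isUnit_shiftOp hz), hu]

theorem IsRelPerturbation.res_eq (hT : IsRelPerturbation T κ R W)
    (hz : ¬ (z.im = 0 ∧ 0 ≤ z.re)) : res T z = pertRes κ z R W :=
  (hT.isResolventAt hz).res_eq

/-- The range of (T - z)⁻¹ = R (1 + W)⁻¹ Q⁻¹ lies in dom H, where Q is `shiftOp κ z R W`, and (H -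
z) R = 1 - (z + κ) R. -/
theorem IsRelPerturbation.opProd_left (hR : IsNegResolvent H κ R) (hT : IsRelPerturbation T κ R W)
    (hz : ¬ (z.im = 0 ∧ 0 ≤ z.re)) :
    opProd (subScalar H z) (ofBounded (res T z)) = ofBounded (pertLeft κ z R W) := by
  have key : ∀ f, (pertRes κ z R W f, pertLeft κ z R W f) ∈ (subScalar H z).graph := by
    intro f
    rw [mem_graph_subScalar, hR.graph_iff]
    refine ⟨Ring.inverse (1 + W) (Ring.inverse (shiftOp κ z R W) f), rfl, ?_⟩
    set g := Ring.inverse (1 + W) (Ring.inverse (shiftOp κ z R W) f)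
    change (g - (z + κ) • R g) + z • R g = _
    rw [add_smul]
    abel
  refine eq_of_mem_graph_iff fun f g => ?_
  rw [mem_graph_opProd, mem_graph_ofBounded, hT.res_eq hz]
  constructor
  · rintro ⟨h, h1, h2⟩
    rw [mem_graph_ofBounded.1 h1] at h2
    exact graph_unique h2 (key f)
  · rintro rfl
    exact ⟨_, mem_graph_ofBounded.2 rfl, key f⟩

theorem IsNegResolvent.inner_eq (hR : IsNegResolvent H κ R) {u v u' v' : E}
    (h : (u, v) ∈ H.graph) (h' : (u', v') ∈ H.graph) : inner ℂ v u' = inner ℂ u v' := by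
  obtain ⟨g, rfl, rfl⟩ := (hR.graph_iff _ _).1 h
  obtain ⟨g', rfl, rfl⟩ := (hR.graph_iff _ _).1 h'
  have hs := (ContinuousLinearMap.isSelfAdjoint_iff_isSymmetric.1 hR.selfAdjoint)
  have h1 : ∀ x y, inner ℂ (R x) y = inner ℂ x (R y) := hs
  rw [inner_sub_left, inner_sub_right, inner_smul_left, inner_smul_right, h1 g g',
    Complex.conj_ofReal]

theorem IsRelPerturbation.star_pertRes (hT : IsRelPerturbation T κ R W)
    (hz : ¬ (z.im = 0 ∧ 0 ≤ z.re)) : star (pertRes κ (conj z) R W) = pertRes κ z R W := by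
  have hc : Commute (shiftOp κ z R W) (pertInv R W) :=
    (Commute.one_left _).sub_left ((Commute.refl _).smul_left _)
  have h1 := hT.isUnit_shiftOp hz
  rw [pertRes, star_mul, ← Ring.inverse_star, hT.star_shiftOp, Complex.conj_conj,
    hT.pertInv_isSelfAdjoint.star_eq, pertRes]
  calc Ring.inverse (shiftOp κ z R W) * pertInv R W
      = Ring.inverse (shiftOp κ z R W) * (pertInv R W * shiftOp κ z R W) *
          Ring.inverse (shiftOp κ z R W) := by
        rw [mul_assoc, mul_assoc, Ring.mul_inverse_cancel _ h1, mul_one]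
    _ = _ := by rw [← hc.eq, ← mul_assoc, Ring.inverse_mul_cancel _ h1, one_mul]

/-- For u in dom H, moving the resolvent and then the symmetric H across the inner product shows
that (T - z)⁻¹ (H - z) u is the bounded adjoint of `pertLeft` at the conjugate point, applied to u.
As dom H is dense, that adjoint is the closure. -/
theorem IsRelPerturbation.opProd_right (hR : IsNegResolvent H κ R) (hT : IsRelPerturbation T κ R W)
    (hz : ¬ (z.im = 0 ∧ 0 ≤ z.re)) :
    (opProd (ofBounded (res T z)) (subScalar H z)).IsClosable ∧
      (opProd (ofBounded (res T z)) (subScalar H z)).closure =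
        ofBounded (star (pertLeft κ (conj z) R W)) := by
  apply isClosable_and_closure_eq_ofBounded
  · refine hR.dense_domain.mono fun u hu => ?_
    obtain ⟨v, hv⟩ := LinearPMap.mem_domain_iff.1 hu
    refine LinearPMap.mem_domain_iff.2 ⟨res T z (v - z • u), mem_graph_opProd.2 ⟨v - z • u, ?_,
      mem_graph_ofBounded.2 rfl⟩⟩
    rwa [mem_graph_subScalar, sub_add_cancel]
  · intro u v huv
    obtain ⟨w, h1, h2⟩ := mem_graph_opProd.1 huv
    obtain rfl := mem_graph_ofBounded.1 h2
    rw [mem_graph_subScalar] at h1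
    rw [hT.res_eq hz]
    refine ext_inner_right ℂ fun f => ?_
    rw [ContinuousLinearMap.star_eq_adjoint, ContinuousLinearMap.adjoint_inner_left]
    have h3 : (pertRes κ (conj z) R W f, pertLeft κ (conj z) R W f) ∈
        (subScalar H (conj z)).graph := by
      have := hT.opProd_left hR (not_conj_nonneg hz)
      have h4 : (f, pertLeft κ (conj z) R W f) ∈
          (opProd (subScalar H (conj z)) (ofBounded (res T (conj z)))).graph := by
        rw [this]; exact mem_graph_ofBounded.2 rfl
      obtain ⟨x, h5, h6⟩ := mem_graph_opProd.1 h4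
      rw [mem_graph_ofBounded.1 h5, hT.res_eq (not_conj_nonneg hz)] at h6
      exact h6
    rw [mem_graph_subScalar] at h3
    have h4 := hR.inner_eq h1 h3
    rw [inner_add_left, inner_add_right, inner_smul_left, inner_smul_right,
      add_left_inj] at h4
    rw [← h4, ← hT.star_pertRes hz, ContinuousLinearMap.star_eq_adjoint,
      ContinuousLinearMap.adjoint_inner_left]

/-- Take adjoints in R = (T + κ)⁻¹ (1 + W), using that R and (T + κ)⁻¹ are self-adjoint. The
relation controls W^* on the range of R by W itself. -/
theorem IsRelPerturbation.star_mul_eq (hR : IsNegResolvent H κ R)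
    (hT : IsRelPerturbation T κ R W) : star W * R = R * W := by
  have hu := isUnit_one_add hT.norm_le
  have h1 : pertInv R W * (1 + W) = R := by
    rw [pertInv, mul_assoc, Ring.inverse_mul_cancel _ hu, mul_one]
  have h2 : (1 + star W) * pertInv R W = R := by
    have := congrArg star h1
    rwa [star_mul, star_add, star_one, hT.pertInv_isSelfAdjoint.star_eq,
      hR.selfAdjoint.star_eq] at this
  have h3 : (1 + star W) * R = R * (1 + W) := by
    rw [← h1, ← mul_assoc, h2, h1]
  rw [add_mul, mul_add, one_mul, mul_one] at h3
  exact add_left_cancel h3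

theorem IsRelPerturbation.star_pertLeft (hR : IsNegResolvent H κ R)
    (hT : IsRelPerturbation T κ R W) (z : ℂ) :
    star (pertLeft κ (conj z) R W) =
      Ring.inverse (shiftOp κ z R W) * (Ring.inverse (1 + star W) * (1 - (z + κ) • R)) := by
  rw [pertLeft, star_mul, star_mul, ← Ring.inverse_star, ← Ring.inverse_star, hT.star_shiftOp,
    Complex.conj_conj, star_add, star_one, star_sub, star_one, star_smul, hR.selfAdjoint.star_eq,
    mul_assoc]
  simp

/-! #### Convergence -/

section Convergence

variable {Tn : ℕ → E →ₗ.[ℂ] E} {Wn : ℕ → E →L[ℂ] E}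

theorem tendsto_inverse_one_add (hT : IsRelPerturbation T κ R W)
    (hTn : ∀ n, IsRelPerturbation (Tn n) κ R (Wn n))
    (hW : ∀ f, Tendsto (fun n => Wn n f) atTop (𝓝 (W f))) (f : E) :
    Tendsto (fun n => Ring.inverse (1 + Wn n) f) atTop (𝓝 (Ring.inverse (1 + W) f)) :=
  tendsto_inverse (fun n => isUnit_one_add (hTn n).norm_le) (isUnit_one_add hT.norm_le)
    (fun n => norm_inverse_one_add_le (hTn n).norm_le) (fun g => (hW g).const_add g) f

theorem tendsto_inverse_shiftOp (hT : IsRelPerturbation T κ R W)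
    (hTn : ∀ n, IsRelPerturbation (Tn n) κ R (Wn n))
    (hW : ∀ f, Tendsto (fun n => Wn n f) atTop (𝓝 (W f))) (hz : ¬ (z.im = 0 ∧ 0 ≤ z.re)) (f : E) :
    Tendsto (fun n => Ring.inverse (shiftOp κ z R (Wn n)) f) atTop
      (𝓝 (Ring.inverse (shiftOp κ z R W) f)) := by
  obtain ⟨c, -, hc⟩ := exists_norm_inverse_shiftOp_le (E := E) κ hz
  refine tendsto_inverse (fun n => (hTn n).isUnit_shiftOp hz) (hT.isUnit_shiftOp hz)
    (fun n => hc _ _ _ (hTn n)) (fun g => ?_) f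
  exact (((R.continuous.tendsto _).comp
    (tendsto_inverse_one_add hT hTn hW g)).const_smul (z + (κ : ℂ))).const_sub g

theorem tendsto_pertLeft (hT : IsRelPerturbation T κ R W)
    (hTn : ∀ n, IsRelPerturbation (Tn n) κ R (Wn n))
    (hW : ∀ f, Tendsto (fun n => Wn n f) atTop (𝓝 (W f))) (hz : ¬ (z.im = 0 ∧ 0 ≤ z.re)) (f : E) :
    Tendsto (fun n => pertLeft κ z R (Wn n) f) atTop (𝓝 (pertLeft κ z R W f)) :=
  (((1 - (z + κ) • R : E →L[ℂ] E).continuous.tendsto _).comp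
    (tendsto_apply_of_tendsto (fun n => norm_inverse_one_add_le (hTn n).norm_le)
      (tendsto_inverse_one_add hT hTn hW) (tendsto_inverse_shiftOp hT hTn hW hz f)))

theorem tendsto_pertRes (hT : IsRelPerturbation T κ R W)
    (hTn : ∀ n, IsRelPerturbation (Tn n) κ R (Wn n))
    (hW : ∀ f, Tendsto (fun n => Wn n f) atTop (𝓝 (W f))) (hz : ¬ (z.im = 0 ∧ 0 ≤ z.re)) (f : E) :
    Tendsto (fun n => pertRes κ z R (Wn n) f) atTop (𝓝 (pertRes κ z R W f)) :=
  ((R.continuous.tendsto _).comp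
    (tendsto_apply_of_tendsto (fun n => norm_inverse_one_add_le (hTn n).norm_le)
      (tendsto_inverse_one_add hT hTn hW) (tendsto_inverse_shiftOp hT hTn hW hz f)))

/-- Taking adjoints is not strongly continuous. Here W_n^* R g = R W_n g converges to R W g = W^* R
g; density of the range of R and ‖W_n^*‖ ≤ 1/2 then give W_n^* → W^* strongly. -/
theorem tendsto_star_pertLeft (hR : IsNegResolvent H κ R) (hT : IsRelPerturbation T κ R W)
    (hTn : ∀ n, IsRelPerturbation (Tn n) κ R (Wn n))
    (hW : ∀ f, Tendsto (fun n => Wn n f) atTop (𝓝 (W f))) (hz : ¬ (z.im = 0 ∧ 0 ≤ z.re)) (f : E) :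
    Tendsto (fun n => star (pertLeft κ (conj z) R (Wn n)) f) atTop
      (𝓝 (star (pertLeft κ (conj z) R W) f)) := by
  have hs : ∀ {V : E →L[ℂ] E}, ‖V‖ ≤ 1 / 2 → ‖star V‖ ≤ 1 / 2 := fun h => by rwa [norm_star]
  have h1 : ∀ g, Tendsto (fun n => star (Wn n) g) atTop (𝓝 (star W g)) := by
    refine tendsto_of_tendsto_denseRange hR.denseRange (fun n => hs (hTn n).norm_le) fun g => ?_
    have e : ∀ {T : E →ₗ.[ℂ] E} {W : E →L[ℂ] E}, IsRelPerturbation T κ R W →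
        star W (R g) = R (W g) := fun h => DFunLike.congr_fun (h.star_mul_eq hR) g
    rw [e hT]
    simp only [fun n => e (hTn n)]
    exact (R.continuous.tendsto _).comp (hW g)
  obtain ⟨c, -, hc⟩ := exists_norm_inverse_shiftOp_le (E := E) κ hz
  simp only [fun n => (hTn n).star_pertLeft hR z, hT.star_pertLeft hR z]
  exact tendsto_apply_of_tendsto (fun n => hc _ _ _ (hTn n)) (tendsto_inverse_shiftOp hT hTn hW hz)
    (tendsto_inverse (fun n => isUnit_one_add (hs (hTn n).norm_le))
      (isUnit_one_add (hs hT.norm_le)) (fun n => norm_inverse_one_add_le (hs (hTn n).norm_le))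
      (fun g => (h1 g).const_add g) _)

theorem exists_norm_pertLeft_le (κ : ℝ) (R : E →L[ℂ] E) (hz : ¬ (z.im = 0 ∧ 0 ≤ z.re)) :
    ∃ c : ℝ, 0 < c ∧ ∀ (T : E →ₗ.[ℂ] E) (W : E →L[ℂ] E), IsRelPerturbation T κ R W →
      ‖pertLeft κ z R W‖ ≤ c := by
  obtain ⟨c, hc0, hc⟩ := exists_norm_inverse_shiftOp_le (E := E) κ hz
  refine ⟨‖(1 - (z + κ) • R : E →L[ℂ] E)‖ * (2 * c) + 1, by positivity, fun T W hT => ?_⟩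
  have h1 := norm_inverse_one_add_le hT.norm_le
  have h2 := hc _ _ _ hT
  calc ‖pertLeft κ z R W‖ ≤ ‖(1 - (z + κ) • R : E →L[ℂ] E)‖ *
        (‖Ring.inverse (1 + W)‖ * ‖Ring.inverse (shiftOp κ z R W)‖) :=
        (norm_mul_le _ _).trans (by gcongr; exact norm_mul_le _ _)
    _ ≤ ‖(1 - (z + κ) • R : E →L[ℂ] E)‖ * (2 * c) := by gcongr
    _ ≤ _ := by linarith

end Convergence

end RelativePerturbation

/-! ### Dominated convergence in `L²(ℝ²)` -/

theorem norm_sq_eq_integral (f : L2) : ‖f‖ ^ 2 = ∫ p, ‖f p‖ ^ 2 := by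
  have h : (inner ℂ f f : ℂ) = ((∫ p, ‖f p‖ ^ 2 : ℝ) : ℂ) := by
    rw [L2.inner_def, ← integral_complex_ofReal]
    refine integral_congr_ae (Eventually.of_forall fun p => ?_)
    simp only [inner_self_eq_norm_sq_to_K]
    push_cast
    rfl
  rw [inner_self_eq_norm_sq_to_K] at h
  exact Complex.ofReal_injective (by rw [← h]; push_cast; rfl)

theorem integrable_norm_sq (f : L2) : Integrable (fun p => ‖f p‖ ^ 2) :=
  (Lp.memLp f).integrable_norm_pow two_ne_zero

theorem tendsto_zero_of_dominated {F : ℕ → L2} {G : L2} {C : ℝ}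
    (hF : ∀ᵐ p, Tendsto (fun n => F n p) atTop (𝓝 0)) (hG : ∀ n, ∀ᵐ p, ‖F n p‖ ≤ C * ‖G p‖) :
    Tendsto F atTop (𝓝 0) := by
  have h : Tendsto (fun n => ∫ p, ‖F n p‖ ^ 2) atTop (𝓝 (∫ _ : Plane, (0 : ℝ))) := by
    refine tendsto_integral_of_dominated_convergence (fun p => C ^ 2 * ‖G p‖ ^ 2)
      (fun n => (integrable_norm_sq (F n)).aestronglyMeasurable)
      ((integrable_norm_sq G).const_mul _) (fun n => ?_) ?_
    · filter_upwards [hG n] with p hp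
      rw [Real.norm_of_nonneg (by positivity), ← mul_pow]
      gcongr
    · filter_upwards [hF] with p hp
      simpa using hp.norm.pow 2
  simp only [integral_zero, ← norm_sq_eq_integral] at h
  rw [tendsto_zero_iff_norm_tendsto_zero]
  simpa using h.sqrt

theorem tendsto_of_dominated {F : ℕ → L2} {F' G : L2} {C : ℝ}
    (hF : ∀ᵐ p, Tendsto (fun n => F n p) atTop (𝓝 (F' p))) (hG : ∀ n, ∀ᵐ p, ‖F n p‖ ≤ C * ‖G p‖) :
    Tendsto F atTop (𝓝 F') := by
  have h0 : ∀ᵐ p, ‖F' p‖ ≤ C * ‖G p‖ := by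
    filter_upwards [hF, ae_all_iff.2 hG] with p h1 h2
    exact le_of_tendsto' h1.norm h2
  have hsub : ∀ᵐ p, ∀ n, (F n - F' : L2) p = F n p - F' p :=
    ae_all_iff.2 fun n => (Lp.coeFn_sub (F n) F').mono fun p hp => hp
  have : Tendsto (fun n => F n - F') atTop (𝓝 0) := by
    refine tendsto_zero_of_dominated (G := G) (C := 2 * C) ?_ fun n => ?_
    · filter_upwards [hF, hsub] with p h1 h2
      simp only [h2]
      simpa using h1.sub_const (F' p)
    · filter_upwards [hG n, h0, hsub] with p h1 h2 h3
      rw [h3]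
      calc ‖F n p - F' p‖ ≤ ‖F n p‖ + ‖F' p‖ := norm_sub_le _ _
        _ ≤ 2 * C * ‖G p‖ := by linarith
  simpa using this.add_const F'

/-! ### Bounded multiplication operators -/

/-- `m` is measurable and bounded by `C`. -/
structure BddBy (m : Plane → ℂ) (C : ℝ) : Prop where
  measurable : Measurable m
  norm_le : ∀ p, ‖m p‖ ≤ C

variable {m m' : Plane → ℂ} {C C' : ℝ}

theorem BddBy.nonneg (h : BddBy m C) : 0 ≤ C := (norm_nonneg _).trans (h.norm_le 0)

theorem BddBy.conj (h : BddBy m C) : BddBy (fun p => conj (m p)) C :=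
  ⟨Complex.continuous_conj.measurable.comp h.measurable, fun p => by simpa using h.norm_le p⟩

theorem BddBy.const_mul (h : BddBy m C) (c : ℂ) : BddBy (fun p => c * m p) (‖c‖ * C) :=
  ⟨h.measurable.const_mul c, fun p => by
    rw [norm_mul]; exact mul_le_mul_of_nonneg_left (h.norm_le p) (norm_nonneg _)⟩

theorem memLp_mul_of_norm_le (hm : Measurable m) (f : L2) {g : L2} {C : ℝ}
    (h : ∀ᵐ p, ‖m p * f p‖ ≤ C * ‖g p‖) : MemLp (fun p => m p * f p) 2 volume :=
  (Lp.memLp g).of_le_mul (hm.aestronglyMeasurable.mul (Lp.aestronglyMeasurable f)) h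

theorem BddBy.norm_mul_le (h : BddBy m C) (f : L2) : ∀ᵐ p, ‖m p * f p‖ ≤ C * ‖f p‖ :=
  Eventually.of_forall fun p => by rw [norm_mul]; gcongr; exact h.norm_le p

theorem BddBy.memLp (h : BddBy m C) (f : L2) : MemLp (fun p => m p * f p) 2 volume :=
  memLp_mul_of_norm_le h.measurable f (h.norm_mul_le f)

open Classical in
/-- Multiplication by a bounded measurable function, as a bounded operator (and `0` if `m` is not
bounded and measurable). -/
def bmul (m : Plane → ℂ) : L2 →L[ℂ] L2 :=
  if h : ∃ C, BddBy m C then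
    LinearMap.mkContinuousOfExistsBound
      { toFun := fun f => (h.choose_spec.memLp f).toLp
        map_add' := fun f g => mul_toLp_add m f g _ _ _
        map_smul' := fun c f => mul_toLp_smul m c f _ _ }
      ⟨h.choose, fun f => Lp.norm_le_mul_norm_of_ae_le_mul (by
        filter_upwards [(h.choose_spec.memLp f).coeFn_toLp, h.choose_spec.norm_mul_le f]
          with p h1 h2
        exact (congrArg norm h1).trans_le h2)⟩
  else 0

theorem BddBy.coeFn_bmul (h : BddBy m C) (f : L2) : bmul m f =ᵐ[volume] fun p => m p * f p := by
  have h' : ∃ C, BddBy m C := ⟨C, h⟩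
  rw [bmul, dif_pos h']
  exact MemLp.coeFn_toLp (h'.choose_spec.memLp f)

theorem BddBy.norm_bmul_le (h : BddBy m C) : ‖bmul m‖ ≤ C := by
  refine ContinuousLinearMap.opNorm_le_bound _ h.nonneg fun f =>
    Lp.norm_le_mul_norm_of_ae_le_mul ?_
  filter_upwards [h.coeFn_bmul f, h.norm_mul_le f] with p h1 h2
  exact (congrArg norm h1).trans_le h2

theorem BddBy.star_bmul (h : BddBy m C) : star (bmul m) = bmul fun p => conj (m p) := by
  rw [ContinuousLinearMap.star_eq_adjoint]
  refine ((ContinuousLinearMap.eq_adjoint_iff _ _).2 fun f g => ?_).symm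
  rw [L2.inner_def, L2.inner_def]
  refine integral_congr_ae ?_
  filter_upwards [h.coeFn_bmul g, h.conj.coeFn_bmul f] with p h1 h2
  simp only [h1, h2, RCLike.inner_apply, map_mul, Complex.conj_conj]
  ring

theorem BddBy.multOp_eq (h : BddBy m C) : multOp m = ofBounded (bmul m) := by
  have key : ∀ u : (multOp m).domain, multOp m u = bmul m u := fun u => Lp.ext (by
    filter_upwards [coeFn_multOp m u, h.coeFn_bmul u] with p h1 h2
    rw [h1, h2])
  refine eq_of_mem_graph_iff fun f g => ?_
  rw [mem_graph_ofBounded]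
  constructor
  · intro hfg
    obtain ⟨u, rfl, rfl⟩ := (LinearPMap.mem_graph_iff _).1 hfg
    exact key u
  · rintro rfl
    have hf : f ∈ (multOp m).domain := h.memLp f
    rw [← key ⟨f, hf⟩]
    exact (multOp m).mem_graph ⟨f, hf⟩

theorem tendsto_bmul {mn : ℕ → Plane → ℂ} (hn : ∀ n, BddBy (mn n) C) (h : BddBy m C')
    (hm : ∀ᵐ p, Tendsto (fun n => mn n p) atTop (𝓝 (m p))) (f : L2) :
    Tendsto (fun n => bmul (mn n) f) atTop (𝓝 (bmul m f)) := by
  have h1 : ∀ᵐ p, ∀ n, bmul (mn n) f p = mn n p * f p := ae_all_iff.2 fun n => (hn n).coeFn_bmul f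
  refine tendsto_of_dominated (G := f) (C := C) ?_ fun n => ?_
  · filter_upwards [h1, h.coeFn_bmul f, hm] with p h1 h2 h3
    simp only [h1, h2]
    exact h3.mul_const _
  · filter_upwards [h1, (hn n).norm_mul_le f] with p h1 h2
    rw [h1]
    exact h2

/-! ### Fourier multipliers -/

/-- The Fourier transform as a unitary operator on `L²(ℝ²)`. -/
abbrev ft : L2 ≃ₗᵢ[ℂ] L2 := Lp.fourierTransformₗᵢ Plane ℂ

/-- The Fourier transform of `g` is `m` times the Fourier transform of `f`. -/
def HasSymbol (m : Plane → ℂ) (f g : L2) : Prop := ft g =ᵐ[volume] fun ξ => m ξ * ft f ξ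

/-- The bounded Fourier multiplier with symbol `m`. -/
def fmul (m : Plane → ℂ) : L2 →L[ℂ] L2 :=
  (ft.symm.toContinuousLinearEquiv : L2 →L[ℂ] L2) * bmul m *
    (ft.toContinuousLinearEquiv : L2 →L[ℂ] L2)

theorem fmul_apply (m : Plane → ℂ) (f : L2) : fmul m f = ft.symm (bmul m (ft f)) := rfl

theorem ft_fmul (m : Plane → ℂ) (f : L2) : ft (fmul m f) = bmul m (ft f) := by
  rw [fmul_apply, LinearIsometryEquiv.apply_symm_apply]

theorem BddBy.hasSymbol_fmul (h : BddBy m C) (f : L2) : HasSymbol m f (fmul m f) := by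
  rw [HasSymbol, ft_fmul]
  exact h.coeFn_bmul _

theorem HasSymbol.unique {f g g' : L2} (h : HasSymbol m f g) (h' : HasSymbol m f g') : g = g' :=
  ft.injective (Lp.ext (EventuallyEq.trans h h'.symm))

theorem HasSymbol.congr {f g : L2} (h : HasSymbol m f g) (hm : ∀ p, m p = m' p) :
    HasSymbol m' f g := by
  rwa [← funext hm]

theorem HasSymbol.comp {f g k : L2} (h : HasSymbol m f g) (h' : HasSymbol m' g k) :
    HasSymbol (fun p => m' p * m p) f k := by
  filter_upwards [h, h'] with p h1 h2
  rw [h2, h1, mul_assoc]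

theorem HasSymbol.add {f g g' : L2} (h : HasSymbol m f g) (h' : HasSymbol m' f g') :
    HasSymbol (fun p => m p + m' p) f (g + g') := by
  have := Lp.coeFn_add (ft g) (ft g')
  rw [← map_add] at this
  filter_upwards [h, h', this] with p h1 h2 h3
  rw [h3, Pi.add_apply, h1, h2, add_mul]

theorem HasSymbol.smul {f g : L2} (h : HasSymbol m f g) (c : ℂ) :
    HasSymbol (fun p => c * m p) f (c • g) := by
  have := Lp.coeFn_smul c (ft g)
  rw [← map_smul] at this
  filter_upwards [h, this] with p h1 h3
  rw [h3, Pi.smul_apply, h1, smul_eq_mul, mul_assoc]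

theorem hasSymbol_one (f : L2) : HasSymbol (fun _ => 1) f f :=
  Eventually.of_forall fun _ => (one_mul _).symm

/-- If the multiplier with symbol `m` is defined at `f`, so is each one dominated by `1 + |m|`. -/
theorem HasSymbol.exists_of_le {f g : L2} (h : HasSymbol m f g) (hm' : Measurable m')
    (hle : ∀ p, ‖m' p‖ ≤ C * (1 + ‖m p‖)) : ∃ g', HasSymbol m' f g' := by
  have h1 : MemLp (fun p => m' p * ft f p) 2 volume := by
    refine ((Lp.memLp (ft f)).norm.add (Lp.memLp (ft g)).norm).of_le_mul (c := C)
      (hm'.aestronglyMeasurable.mul (Lp.aestronglyMeasurable _)) ?_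
    filter_upwards [h] with p hp
    simp only [Pi.add_apply]
    rw [hp, norm_mul, norm_mul, Real.norm_of_nonneg (by positivity)]
    calc ‖m' p‖ * ‖ft f p‖ ≤ C * (1 + ‖m p‖) * ‖ft f p‖ := by gcongr; exact hle p
      _ = _ := by ring
  refine ⟨ft.symm h1.toLp, ?_⟩
  rw [HasSymbol, LinearIsometryEquiv.apply_symm_apply]
  exact h1.coeFn_toLp

theorem HasSymbol.inner_eq {f g u v : L2} (h : HasSymbol m f g)
    (h' : HasSymbol (fun p => conj (m p)) u v) : inner ℂ g u = inner ℂ f v := by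
  rw [← ft.inner_map_map g u, ← ft.inner_map_map f v, L2.inner_def, L2.inner_def]
  refine integral_congr_ae ?_
  filter_upwards [h, h'] with p h1 h2
  simp only [h1, h2, RCLike.inner_apply, map_mul]
  ring

theorem BddBy.norm_fmul_le (h : BddBy m C) : ‖fmul m‖ ≤ C := by
  refine ContinuousLinearMap.opNorm_le_bound _ h.nonneg fun f => ?_
  rw [fmul_apply, LinearIsometryEquiv.norm_map, ← ft.norm_map f]
  exact (bmul m).le_of_opNorm_le h.norm_bmul_le _

theorem BddBy.star_fmul (h : BddBy m C) : star (fmul m) = fmul fun p => conj (m p) := by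
  rw [ContinuousLinearMap.star_eq_adjoint]
  exact ((ContinuousLinearMap.eq_adjoint_iff _ _).2 fun f g =>
    (h.conj.hasSymbol_fmul f).inner_eq
      ((h.hasSymbol_fmul g).congr fun p => (Complex.conj_conj _).symm)).symm

theorem BddBy.fmul_isSelfAdjoint (h : BddBy m C) (hm : ∀ p, conj (m p) = m p) :
    IsSelfAdjoint (fmul m) := by
  rw [IsSelfAdjoint, h.star_fmul]
  simp only [hm]

theorem tendsto_fmul {mn : ℕ → Plane → ℂ} (hn : ∀ n, BddBy (mn n) C) (h : BddBy m C')
    (hm : ∀ᵐ p, Tendsto (fun n => mn n p) atTop (𝓝 (m p))) (f : L2) :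
    Tendsto (fun n => fmul (mn n) f) atTop (𝓝 (fmul m f)) := by
  simp only [fmul_apply]
  exact (ft.symm.continuous.tendsto _).comp (tendsto_bmul hn h hm _)

/-- A bounded multiplier commutes with every multiplier. -/
theorem HasSymbol.fmul {f g : L2} (h : HasSymbol m f g) (h' : BddBy m' C') :
    HasSymbol m (fmul m' f) (fmul m' g) := by
  filter_upwards [h, h'.hasSymbol_fmul f, h'.hasSymbol_fmul g] with p h1 h2 h3
  rw [h3, h2, h1, mul_left_comm]

/-! ### Weak derivatives as Fourier multipliers -/

/-- The Fourier transform is injective on tempered distributions and turns ∂/∂p_i into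
multiplication by 2πi ξ_i; what remains is to pass between equality of distributions and equality
almost everywhere. -/
theorem weakDeriv_graph_iff_hasSymbol (i : Fin 2) (f g : L2) :
    (f, g) ∈ (weakDeriv i).graph ↔
      HasSymbol (fun ξ => Complex.I * ((2 * Real.pi * ξ i : ℝ) : ℂ)) f g := by
  have hinj : Function.Injective (fun T : 𝓢'(Plane, ℂ) => 𝓕 T) :=
    fun S T h => by simpa using congrArg (fun T : 𝓢'(Plane, ℂ) => 𝓕⁻ T) h
  have htg : (fun ξ : Plane =>
      ((inner ℝ ξ (EuclideanSpace.single i (1 : ℝ)) : ℝ) : ℂ)).HasTemperateGrowth := by fun_prop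
  have hin : ∀ ξ : Plane, inner ℝ ξ (EuclideanSpace.single i (1 : ℝ)) = ξ i := by
    intro ξ
    simp [EuclideanSpace.inner_single_right]
  rw [weakDeriv_graph, ← hinj.eq_iff]
  simp only
  rw [TemperedDistribution.fourier_lineDerivOp_eq, Lp.fourier_toTemperedDistribution_eq,
    Lp.fourier_toTemperedDistribution_eq]
  change _ • _ = ((ft g : L2) : 𝓢'(Plane, ℂ)) ↔ _
  change _ • TemperedDistribution.smulLeftCLM ℂ _ ((ft f : L2) : 𝓢'(Plane, ℂ)) = _ ↔ _
  have key : ∀ ψ : 𝓢(Plane, ℂ), ((2 * Real.pi * Complex.I) •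
      TemperedDistribution.smulLeftCLM ℂ
        (fun ξ : Plane => ((inner ℝ ξ (EuclideanSpace.single i (1 : ℝ)) : ℝ) : ℂ))
        ((ft f : L2) : 𝓢'(Plane, ℂ))) ψ =
      ∫ ξ, ψ ξ * (Complex.I * ((2 * Real.pi * ξ i : ℝ) : ℂ) * ft f ξ) := by
    intro ψ
    change (2 * Real.pi * Complex.I) • (((ft f : L2) : 𝓢'(Plane, ℂ)) _) = _
    rw [Lp.toTemperedDistribution_apply, ← integral_smul]
    refine integral_congr_ae (Eventually.of_forall fun ξ => ?_)
    have h1 := SchwartzMap.smulLeftCLM_apply_apply htg ψ ξ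
    change (2 * Real.pi * Complex.I) • (SchwartzMap.smulLeftCLM ℂ (fun ξ : Plane =>
      ((inner ℝ ξ (EuclideanSpace.single i (1 : ℝ)) : ℝ) : ℂ)) ψ ξ • ft f ξ) = _
    rw [h1]
    simp only [hin, smul_eq_mul]
    push_cast
    ring
  constructor
  · intro h
    refine EventuallyEq.symm ?_
    -- Smooth compactly supported real functions are Schwartz functions after complexification, and
    -- they separate locally integrable functions.
    refine ae_eq_of_integral_contDiff_smul_eq ?_
      ((Lp.memLp (ft g)).locallyIntegrable one_le_two) fun η hη hηc => ?_
    · exact locallyIntegrableOn_univ.1 (((locallyIntegrableOn_univ.2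
        ((Lp.memLp (ft f)).locallyIntegrable one_le_two)).continuousOn_mul
          (by fun_prop) isOpen_univ.isLocallyClosed))
    · have hg₁ : HasCompactSupport (Complex.ofRealCLM ∘ η) := hηc.comp_left rfl
      have hg₂ : ContDiff ℝ ((⊤ : ℕ∞) : WithTop ℕ∞) (Complex.ofRealCLM ∘ η) :=
        Complex.ofRealCLM.contDiff.comp hη
      have h1 := key (hg₁.toSchwartzMap hg₂)
      rw [h, Lp.toTemperedDistribution_apply] at h1
      simpa using h1.symm
  · intro h
    ext ψ
    rw [key, Lp.toTemperedDistribution_apply]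
    refine integral_congr_ae ?_
    filter_upwards [h] with ξ hξ
    rw [hξ, smul_eq_mul]

/-! ### Translations and difference quotients -/

/-- The translation `f ↦ f(· + v)` on `L²(ℝ²)`. -/
def transl (v : Plane) : L2 →ₗᵢ[ℂ] L2 :=
  Lp.compMeasurePreservingₗᵢ ℂ (· + v) (measurePreserving_add_right volume v)

theorem coeFn_transl (v : Plane) (f : L2) : transl v f =ᵐ[volume] fun p => f (p + v) :=
  Lp.coeFn_compMeasurePreserving f (measurePreserving_add_right volume v)

/-- The translation of a Schwartz function. -/
def schwartzTransl (v : Plane) : 𝓢(Plane, ℂ) →L[ℂ] 𝓢(Plane, ℂ) :=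
  SchwartzMap.compCLMOfAntilipschitz ℂ (K := 1) (g := fun p : Plane => p + v) (by fun_prop)
    (AntilipschitzWith.of_le_mul_dist fun p q => by simp)

theorem schwartzTransl_apply (v p : Plane) (ψ : 𝓢(Plane, ℂ)) :
    schwartzTransl v ψ p = ψ (p + v) := rfl

/-- The symbol of the translation by `v`. -/
def translSymbol (v ξ : Plane) : ℂ := Complex.exp (Complex.I * ((2 * Real.pi * inner ℝ v ξ : ℝ) : ℂ))

theorem bddBy_translSymbol (v : Plane) : BddBy (translSymbol v) 1 where
  measurable := by unfold translSymbol; fun_prop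
  norm_le ξ := by rw [translSymbol, Complex.norm_exp_I_mul_ofReal]

theorem fourier_schwartzTransl (v ξ : Plane) (ψ : 𝓢(Plane, ℂ)) :
    𝓕 (schwartzTransl v ψ) ξ = translSymbol v ξ * 𝓕 ψ ξ := by
  rw [SchwartzMap.fourier_coe, SchwartzMap.fourier_coe]
  have h := congrFun (VectorFourier.fourierIntegral_comp_add_right Real.fourierChar volume
    (innerₗ Plane) (ψ : Plane → ℂ) v) ξ
  refine h.trans ?_
  rw [Circle.smul_def, Real.fourierChar_apply, translSymbol, smul_eq_mul, mul_comm Complex.I]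
  rfl

/-- Both sides are continuous in f, so it suffices to check Schwartz functions, where the Fourier
integral is explicit. -/
theorem ft_transl (v : Plane) (f : L2) : ft (transl v f) = bmul (translSymbol v) (ft f) := by
  refine DenseRange.induction_on (p := fun f => ft (transl v f) = bmul (translSymbol v) (ft f))
    (SchwartzMap.denseRange_toLpCLM (F := ℂ) (μ := (volume : Measure Plane)) (p := 2)
      ENNReal.ofNat_ne_top) f ?_ fun ψ => ?_
  · exact isClosed_eq (ft.continuous.comp (transl v).continuous)
      ((bmul (translSymbol v)).continuous.comp ft.continuous)
  · have h1 : transl v (ψ.toLp 2 volume) = (schwartzTransl v ψ).toLp 2 volume := by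
      refine Lp.ext ?_
      filter_upwards [coeFn_transl v (ψ.toLp 2 volume), (schwartzTransl v ψ).coeFn_toLp 2 volume,
        (measurePreserving_add_right (volume : Measure Plane) v).quasiMeasurePreserving.ae
          (ψ.coeFn_toLp 2 volume)] with p h1 h2 h3
      rw [h1, h2, h3, schwartzTransl_apply]
    have h2 : ∀ η : 𝓢(Plane, ℂ), ft (η.toLp 2 volume) = (𝓕 η).toLp 2 volume :=
      SchwartzMap.toLp_fourier_eq
    change ft (transl v (ψ.toLp 2 volume)) = bmul (translSymbol v) (ft (ψ.toLp 2 volume))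
    rw [h1, h2, h2]
    refine Lp.ext ?_
    filter_upwards [(𝓕 (schwartzTransl v ψ)).coeFn_toLp 2 volume, (𝓕 ψ).coeFn_toLp 2 volume,
      (bddBy_translSymbol v).coeFn_bmul ((𝓕 ψ).toLp 2 volume)] with p h1 h2 h3
    rw [h1, h3, h2, fourier_schwartzTransl]

/-- The step sizes `1 / (k + 1)` of the difference quotients. -/
def step (k : ℕ) : ℝ := 1 / ((k : ℝ) + 1)

theorem step_pos (k : ℕ) : 0 < step k := by unfold step; positivity

theorem tendsto_step : Tendsto step atTop (𝓝[≠] 0) :=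
  tendsto_nhdsWithin_iff.2 ⟨tendsto_one_div_add_atTop_nhds_zero_nat,
    Eventually.of_forall fun k => (step_pos k).ne'⟩

/-- The coordinate vectors. -/
abbrev coordVec (i : Fin 2) : Plane := EuclideanSpace.single i (1 : ℝ)

/-- The difference quotient of `f` in the direction of the `i`-th coordinate. -/
def diffQuot (i : Fin 2) (k : ℕ) (f : L2) : L2 :=
  ((step k)⁻¹ : ℂ) • (transl (step k • coordVec i) f - f)

theorem translSymbol_coordVec (i : Fin 2) (h : ℝ) (ξ : Plane) :
    translSymbol (h • coordVec i) ξ =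
      Complex.exp (Complex.I * ((h * (2 * Real.pi * ξ i) : ℝ) : ℂ)) := by
  rw [translSymbol, inner_smul_left, EuclideanSpace.inner_single_left]
  congr 3
  simp
  ring

theorem ft_diffQuot (i : Fin 2) (k : ℕ) (f : L2) :
    ft (diffQuot i k f) =ᵐ[volume] fun ξ => ((step k)⁻¹ : ℂ) *
      (Complex.exp (Complex.I * ((step k * (2 * Real.pi * ξ i) : ℝ) : ℂ)) - 1) * ft f ξ := by
  rw [diffQuot, map_smul, map_sub, ft_transl]
  filter_upwards [Lp.coeFn_smul ((step k)⁻¹ : ℂ)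
      (bmul (translSymbol (step k • coordVec i)) (ft f) - ft f),
    Lp.coeFn_sub (bmul (translSymbol (step k • coordVec i)) (ft f)) (ft f),
    (bddBy_translSymbol (step k • coordVec i)).coeFn_bmul (ft f)] with ξ h1 h2 h3
  rw [h1, Pi.smul_apply, h2, Pi.sub_apply, h3, translSymbol_coordVec, smul_eq_mul]
  ring

theorem tendsto_symbol (s : ℝ) :
    Tendsto (fun k => ((step k)⁻¹ : ℂ) * (Complex.exp (Complex.I * ((step k * s : ℝ) : ℂ)) - 1))
      atTop (𝓝 (Complex.I * s)) := by
  have h : HasDerivAt (fun t : ℝ => Complex.exp (Complex.I * ((t * s : ℝ) : ℂ)))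
      (Complex.I * s) 0 := by
    have h1 : HasDerivAt (fun t : ℝ => Complex.I * ((t * s : ℝ) : ℂ)) (Complex.I * s) 0 := by
      have := ((hasDerivAt_id (0 : ℝ)).mul_const s).ofReal_comp.const_mul Complex.I
      simpa using this
    simpa using h1.cexp
  have h2 := (hasDerivAt_iff_tendsto_slope_zero.1 h).comp tendsto_step
  refine h2.congr fun k => ?_
  simp

/-- On the Fourier side the quotients have symbols (e^{ihs} - 1)/h, where s = 2πξ_i; these tend to i
s and are dominated by |s|. Conversely, an L² limit is identified along an almost everywhere
convergent subsequence. The criterion yields a product rule for coefficients that are only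
Lipschitz. -/
theorem weakDeriv_graph_iff_tendsto (i : Fin 2) (f g : L2) :
    (f, g) ∈ (weakDeriv i).graph ↔ Tendsto (fun k => diffQuot i k f) atTop (𝓝 g) := by
  rw [weakDeriv_graph_iff_hasSymbol]
  have hq : ∀ᵐ ξ, ∀ k, ft (diffQuot i k f) ξ = ((step k)⁻¹ : ℂ) *
      (Complex.exp (Complex.I * ((step k * (2 * Real.pi * ξ i) : ℝ) : ℂ)) - 1) * ft f ξ :=
    ae_all_iff.2 fun k => ft_diffQuot i k f
  constructor
  · intro h
    have h1 : Tendsto (fun k => ft (diffQuot i k f)) atTop (𝓝 (ft g)) := by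
      refine tendsto_of_dominated (G := ft g) (C := 1) ?_ fun k => ?_
      · filter_upwards [h, hq] with ξ h1 h2
        simp only [h1, h2]
        exact (tendsto_symbol _).mul_const _
      · filter_upwards [h, hq] with ξ h1 h2
        rw [h1, h2, one_mul, norm_mul, norm_mul, norm_mul]
        refine mul_le_mul_of_nonneg_right ?_ (norm_nonneg _)
        rw [norm_mul, Complex.norm_I, one_mul, norm_inv, Complex.norm_real, Complex.norm_real,
          inv_mul_le_iff₀ (norm_pos_iff.2 (step_pos k).ne'), ← norm_mul]
        exact Real.norm_exp_I_mul_ofReal_sub_one_le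
    simpa [Function.comp_def] using (ft.symm.continuous.tendsto _).comp h1
  · intro h
    have h1 : Tendsto (fun k => ft (diffQuot i k f)) atTop (𝓝 (ft g)) :=
      (ft.continuous.tendsto _).comp h
    obtain ⟨ns, hns, hns'⟩ := (tendstoInMeasure_of_tendsto_Lp h1).exists_seq_tendsto_ae
    filter_upwards [hns', hq] with ξ h2 h3
    simp only [h3] at h2
    exact tendsto_nhds_unique h2
      (((tendsto_symbol (2 * Real.pi * ξ i)).mul_const _).comp hns.tendsto_atTop)

/-! ### The product rule -/

/-- `b'` is the partial derivative of the bounded Lipschitz function `b` along the `i`-th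
coordinate. -/
structure HasBddPartial (i : Fin 2) (b b' : Plane → ℂ) : Prop where
  bdd : ∃ C, BddBy b C
  bdd_deriv : ∃ C, BddBy b' C
  lip : ∃ L, ∀ p (h : ℝ), ‖b (p + h • coordVec i) - b p‖ ≤ L * |h|
  tendsto : ∀ᵐ p, Tendsto (fun k => ((step k)⁻¹ : ℂ) * (b (p + step k • coordVec i) - b p)) atTop
    (𝓝 (b' p))

theorem BddBy.shift {b : Plane → ℂ} {C : ℝ} (h : BddBy b C) (v : Plane) :
    BddBy (fun p => b (p + v)) C :=
  ⟨h.measurable.comp (measurable_add_const v), fun _ => h.norm_le _⟩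

theorem transl_bmul {b : Plane → ℂ} {C : ℝ} (h : BddBy b C) (v : Plane) (f : L2) :
    transl v (bmul b f) = bmul (fun p => b (p + v)) (transl v f) := by
  refine Lp.ext ?_
  filter_upwards [coeFn_transl v (bmul b f), coeFn_transl v f, (h.shift v).coeFn_bmul (transl v f),
    (measurePreserving_add_right (volume : Measure Plane) v).quasiMeasurePreserving.ae
      (h.coeFn_bmul f)] with p h1 h2 h3 h4
  rw [h1, h4, h3, h2]

/-- Discrete Leibniz rule: the difference quotient of b f is the shifted b times that of f, plus
that of b times f. The Lipschitz bound makes the quotients of b a bounded sequence of multipliers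
converging almost everywhere. -/
theorem HasBddPartial.weakDeriv_bmul {i : Fin 2} {b b' : Plane → ℂ} (hb : HasBddPartial i b b')
    {f g : L2} (hfg : (f, g) ∈ (weakDeriv i).graph) :
    (bmul b f, bmul b g + bmul b' f) ∈ (weakDeriv i).graph := by
  obtain ⟨C, hC⟩ := hb.bdd
  obtain ⟨C', hC'⟩ := hb.bdd_deriv
  obtain ⟨L, hL⟩ := hb.lip
  rw [weakDeriv_graph_iff_tendsto] at hfg ⊢
  set q : ℕ → Plane → ℂ := fun k p => ((step k)⁻¹ : ℂ) * (b (p + step k • coordVec i) - b p)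
  have hq : ∀ k, BddBy (q k) L := fun k => by
    refine ⟨(((hC.shift _).measurable).sub hC.measurable).const_mul _, fun p => ?_⟩
    have h1 := hL p (step k)
    rw [norm_mul, norm_inv, Complex.norm_real, Real.norm_eq_abs,
      inv_mul_le_iff₀ (abs_pos.2 (step_pos k).ne'), mul_comm]
    exact h1
  have hshift : ∀ p, Tendsto (fun k => b (p + step k • coordVec i)) atTop (𝓝 (b p)) := by
    intro p
    rw [tendsto_iff_norm_sub_tendsto_zero]
    refine squeeze_zero (fun _ => norm_nonneg _) (fun k => hL p (step k)) ?_
    have := (tendsto_nhdsWithin_iff.1 tendsto_step).1.abs.const_mul L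
    simpa using this
  have h1 := tendsto_apply_of_tendsto (K := fun k => bmul fun p => b (p + step k • coordVec i))
    (fun k => (hC.shift _).norm_bmul_le)
    (tendsto_bmul (fun k => hC.shift _) hC (Eventually.of_forall hshift)) hfg
  have h2 := tendsto_bmul hq hC' hb.tendsto f
  refine (h1.add h2).congr fun k => ?_
  have h3 : bmul (q k) f =
      ((step k)⁻¹ : ℂ) • (bmul (fun p => b (p + step k • coordVec i)) f - bmul b f) := by
    refine Lp.ext ?_
    filter_upwards [(hq k).coeFn_bmul f, (hC.shift (step k • coordVec i)).coeFn_bmul f,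
      hC.coeFn_bmul f,
      Lp.coeFn_smul ((step k)⁻¹ : ℂ) (bmul (fun p => b (p + step k • coordVec i)) f - bmul b f),
      Lp.coeFn_sub (bmul (fun p => b (p + step k • coordVec i)) f) (bmul b f)] with p h1 h2 h3 h4 h5
    rw [h1, h4, Pi.smul_apply, h5, Pi.sub_apply, h2, h3, smul_eq_mul, mul_assoc, sub_mul]
  rw [h3, diffQuot, diffQuot, transl_bmul hC, map_smul, ← smul_add, map_sub]
  congr 1
  abel

/-! ### Absolutely continuous functions with bounded derivative -/

theorem exists_lipschitzWith_of_ac {φ : ℝ → ℝ} (hac : ∀ a b : ℝ, AbsolutelyContinuousOnInterval φ a b)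
    (hd : MemLp (deriv φ) ∞ volume) : ∃ L : NNReal, LipschitzWith L φ := by
  have hae : ∀ᵐ x, ‖deriv φ x‖ ≤ (eLpNorm (deriv φ) ∞ volume).toReal := by
    rw [eLpNorm_exponent_top]
    filter_upwards [ae_le_eLpNormEssSup (f := deriv φ) (μ := volume)] with x hx
    have := ENNReal.toReal_mono (by simpa using hd.2.ne) hx
    simpa using this
  refine ⟨(eLpNorm (deriv φ) ∞ volume).toNNReal, LipschitzWith.of_dist_le_mul fun x y => ?_⟩
  -- Absolute continuity enters here: the increment is the integral of the essentially bounded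
  -- derivative.
  rw [dist_eq_norm, dist_eq_norm, ← (hac y x).integral_deriv_eq_sub]
  exact intervalIntegral.norm_integral_le_of_norm_le_const_ae (hae.mono fun t ht _ => ht)

theorem exists_abs_le_of_memLp_top {φ : ℝ → ℝ} (hc : Continuous φ) (hb : MemLp φ ∞ volume) :
    ∃ C : ℝ, ∀ x, |φ x| ≤ C := by
  have hae : ∀ᵐ x, ‖φ x‖ ≤ (eLpNorm φ ∞ volume).toReal := by
    rw [eLpNorm_exponent_top]
    filter_upwards [ae_le_eLpNormEssSup (f := φ) (μ := volume)] with x hx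
    have := ENNReal.toReal_mono (by simpa using hb.2.ne) hx
    simpa using this
  refine ⟨(eLpNorm φ ∞ volume).toReal, fun x => ?_⟩
  -- The set where the essential bound holds has full measure, hence is dense, and is closed by
  -- continuity.
  have hcl : IsClosed {x | ‖φ x‖ ≤ (eLpNorm φ ∞ volume).toReal} :=
    isClosed_le hc.norm continuous_const
  have := (Measure.dense_of_ae hae).closure_eq
  rw [hcl.closure_eq] at this
  exact (this ▸ Set.mem_univ x : x ∈ {x | ‖φ x‖ ≤ (eLpNorm φ ∞ volume).toReal})

theorem ae_plane_of_ae (i : Fin 2) {P : ℝ → Prop} (h : ∀ᵐ t, P t) : ∀ᵐ p : Plane, P (p i) := by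
  have h1 : Measure.QuasiMeasurePreserving (fun p : Plane => p i) volume volume :=
    (Measure.quasiMeasurePreserving_eval (fun _ : Fin 2 => (volume : Measure ℝ)) i).comp
      (PiLp.volume_preserving_ofLp (Fin 2)).quasiMeasurePreserving
  exact h1.ae h

/-- The partial derivative of a product of functions of one coordinate each. -/
theorem hasBddPartial_prod (i : Fin 2) {α β : ℝ → ℝ} {L : NNReal} {C C' : ℝ} {j : Fin 2} (hj : j ≠ i)
    (hα : LipschitzWith L α) (hαb : ∀ x, |α x| ≤ C) (hβ : Measurable β) (hβb : ∀ x, |β x| ≤ C') :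
    HasBddPartial i (fun p => ((α (p i) * β (p j) : ℝ) : ℂ))
      fun p => ((deriv α (p i) * β (p j) : ℝ) : ℂ) := by
  have hC0 : 0 ≤ C := (abs_nonneg _).trans (hαb 0)
  have hv : ∀ (p : Plane) (h : ℝ), (p + h • coordVec i) i = p i + h := fun p h => by simp
  have hv' : ∀ (p : Plane) (h : ℝ), (p + h • coordVec i) j = p j := fun p h => by simp [hj]
  refine ⟨⟨C * C', ?_, fun p => ?_⟩, ⟨L * C', ?_, fun p => ?_⟩, ⟨L * C', fun p h => ?_⟩, ?_⟩
  · have := hα.continuous.measurable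
    fun_prop
  · rw [Complex.norm_real, norm_mul]
    exact mul_le_mul (hαb _) (hβb _) (norm_nonneg _) hC0
  · have := measurable_deriv α
    fun_prop
  · rw [Complex.norm_real, norm_mul]
    exact mul_le_mul (norm_deriv_le_of_lipschitz hα) (hβb _) (norm_nonneg _) L.coe_nonneg
  · rw [hv, hv', ← Complex.ofReal_sub, Complex.norm_real, ← sub_mul, norm_mul]
    have := hα.dist_le_mul (p i + h) (p i)
    rw [dist_eq_norm, dist_eq_norm, add_sub_cancel_left] at this
    calc ‖α (p i + h) - α (p i)‖ * ‖β (p j)‖ ≤ (L * ‖h‖) * C' :=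
          mul_le_mul this (hβb _) (norm_nonneg _) (by positivity)
      _ = L * C' * |h| := by rw [Real.norm_eq_abs]; ring
  · filter_upwards [ae_plane_of_ae i hα.ae_differentiableAt_real] with p hp
    simp only [hv, hv']
    have h1 := (hasDerivAt_iff_tendsto_slope_zero.1 hp.hasDerivAt).comp tendsto_step
    have h2 := (Complex.continuous_ofReal.tendsto _).comp (h1.mul_const (β (p j)))
    refine h2.congr fun k => ?_
    simp
    ring

/-! ### The free operator -/

/-- The frequency variable dual to the `i`-th coordinate. -/
def freq (i : Fin 2) (ξ : Plane) : ℝ := 2 * Real.pi * ξ i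

theorem measurable_freq (i : Fin 2) : Measurable (freq i) := by unfold freq; fun_prop

theorem mem_graph_ddt {f g : L2} :
    (f, g) ∈ ddt.graph ↔ HasSymbol (fun ξ => Complex.I * (freq 0 ξ : ℂ)) f g :=
  weakDeriv_graph_iff_hasSymbol 0 f g

theorem mem_graph_Aminus {f g : L2} :
    (f, g) ∈ Aminus.graph ↔ HasSymbol (fun ξ => (freq 1 ξ : ℂ)) f g := by
  have hI : ∀ x : ℂ, Complex.I * (-Complex.I * x) = x := fun x => by
    rw [← mul_assoc, mul_neg, Complex.I_mul_I, neg_neg, one_mul]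
  rw [Aminus, mem_graph_smul]
  constructor
  · rintro ⟨g', h, rfl⟩
    rw [weakDeriv_graph_iff_hasSymbol] at h
    refine (h.smul (-Complex.I)).congr fun ξ => ?_
    rw [mul_left_comm, hI]
    rfl
  · intro h
    refine ⟨Complex.I • g, (weakDeriv_graph_iff_hasSymbol 1 f _).2 (h.smul Complex.I), ?_⟩
    rw [smul_smul, neg_mul, Complex.I_mul_I, neg_neg, one_smul]

/-- The symbol `|2πξ|²` of `H₀`. -/
def laplSymbol (ξ : Plane) : ℝ := freq 0 ξ ^ 2 + freq 1 ξ ^ 2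

theorem measurable_laplSymbol : Measurable laplSymbol :=
  ((measurable_freq 0).pow_const 2).add ((measurable_freq 1).pow_const 2)

theorem laplSymbol_nonneg (ξ : Plane) : 0 ≤ laplSymbol ξ := by unfold laplSymbol; positivity

theorem HasSymbol.of_comp {m m' : Plane → ℂ} {f g k : L2} (h : HasSymbol m f g)
    (h' : HasSymbol (fun p => m' p * m p) f k) : HasSymbol m' g k := by
  filter_upwards [h, h'] with p h1 h2
  rw [h2, h1, mul_assoc]

theorem abs_freq_mul_le (i k : Fin 2) (ξ : Plane) : |freq i ξ| * |freq k ξ| ≤ laplSymbol ξ := by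
  have h : ∀ i : Fin 2, |freq i ξ| ^ 2 ≤ laplSymbol ξ := by
    intro i
    rw [sq_abs, laplSymbol]
    fin_cases i
    · exact le_add_of_nonneg_right (sq_nonneg _)
    · exact le_add_of_nonneg_left (sq_nonneg _)
  nlinarith [h i, h k, sq_nonneg (|freq i ξ| - |freq k ξ|)]

theorem abs_freq_le (i : Fin 2) (ξ : Plane) : |freq i ξ| ≤ 1 + laplSymbol ξ := by
  have := abs_freq_mul_le i i ξ
  nlinarith [sq_nonneg (|freq i ξ| - 1), abs_nonneg (freq i ξ)]

theorem mem_graph_domRestrict {T : L2 →ₗ.[ℂ] L2} {S : Submodule ℂ L2} {f g : L2} :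
    (f, g) ∈ (T.domRestrict S).graph ↔ f ∈ S ∧ (f, g) ∈ T.graph := by
  constructor
  · intro h
    refine ⟨?_, LinearPMap.le_graph_of_le LinearPMap.domRestrict_le h⟩
    exact (LinearPMap.mem_domain_of_mem_graph h).1
  · rintro ⟨hS, h⟩
    have hf : f ∈ (T.domRestrict S).domain := ⟨hS, LinearPMap.mem_domain_of_mem_graph h⟩
    have h' := (T.domRestrict S).mem_graph ⟨f, hf⟩
    rwa [graph_unique (LinearPMap.le_graph_of_le LinearPMap.domRestrict_le h') h] at h'

/-- The products |2πξ_i| |2πξ_k| and the first powers are bounded by 1 + |2πξ|², so a square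
integrable Laplacian alone already forces membership in W^{2,2}. -/
theorem mem_graph_H0 {f g : L2} :
    (f, g) ∈ H0.graph ↔ HasSymbol (fun ξ => (laplSymbol ξ : ℂ)) f g := by
  rw [H0, mem_graph_domRestrict, mem_graph_add]
  have hsym : ∀ {g₁ g₂ : L2}, (f, -g₁) ∈ (opProd ddt ddt).graph → (f, g₂) ∈ (opProd Aminus Aminus).graph →
      HasSymbol (fun ξ => (laplSymbol ξ : ℂ)) f (g₁ + g₂) := by
    intro g₁ g₂ h1 h2
    obtain ⟨a, h3, h4⟩ := mem_graph_opProd.1 h1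
    obtain ⟨b, h5, h6⟩ := mem_graph_opProd.1 h2
    have h7 := (((mem_graph_ddt.1 h3).comp (mem_graph_ddt.1 h4)).smul (-1)).add
      ((mem_graph_Aminus.1 h5).comp (mem_graph_Aminus.1 h6))
    rw [neg_one_smul, neg_neg] at h7
    refine h7.congr fun ξ => ?_
    rw [laplSymbol]
    push_cast
    linear_combination (-(freq 0 ξ : ℂ) ^ 2) * Complex.I_sq
  constructor
  · rintro ⟨-, g₁, g₂, h1, h2, rfl⟩
    exact hsym (mem_graph_neg.1 h1) h2
  · intro h
    have hI : ∀ i : Fin 2, ∀ k : Fin 2, ∃ g' g'' : L2,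
        HasSymbol (fun ξ => Complex.I * (freq k ξ : ℂ)) f g' ∧
        HasSymbol (fun ξ => Complex.I * (freq i ξ : ℂ)) g' g'' := by
      intro i k
      obtain ⟨g', hg'⟩ := h.exists_of_le (C := 1)
        (m' := fun ξ => Complex.I * (freq k ξ : ℂ)) (by have := measurable_freq k; fun_prop) (by
          intro ξ
          rw [norm_mul, Complex.norm_I, one_mul, one_mul, Complex.norm_real, Complex.norm_real,
            Real.norm_of_nonneg (laplSymbol_nonneg ξ)]
          exact abs_freq_le k ξ)
      obtain ⟨g'', hg''⟩ := h.exists_of_le (C := 1)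
        (m' := fun ξ => Complex.I * (freq i ξ : ℂ) * (Complex.I * (freq k ξ : ℂ)))
        (by have := measurable_freq k; have := measurable_freq i; fun_prop) (by
          intro ξ
          rw [norm_mul, norm_mul, norm_mul, Complex.norm_I, one_mul, one_mul, one_mul,
            Complex.norm_real, Complex.norm_real, Complex.norm_real,
            Real.norm_of_nonneg (laplSymbol_nonneg ξ)]
          exact (abs_freq_mul_le i k ξ).trans (by linarith))
      exact ⟨g', g'', hg', hg'.of_comp hg''⟩
    have hW : ∀ i k : Fin 2, ∃ g'', (f, g'') ∈ (opProd (weakDeriv i) (weakDeriv k)).graph := by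
      intro i k
      obtain ⟨g', g'', h1, h2⟩ := hI i k
      exact ⟨g'', mem_graph_opProd.2 ⟨g', (weakDeriv_graph_iff_hasSymbol k _ _).2 h1,
        (weakDeriv_graph_iff_hasSymbol i _ _).2 h2⟩⟩
    refine ⟨?_, ?_⟩
    · simp only [W22, Submodule.mem_iInf]
      intro i k
      exact LinearPMap.mem_domain_iff.2 (hW i k)
    · obtain ⟨g₁, h1⟩ := hW 0 0
      obtain ⟨g₂, h2⟩ := hW 1 1
      have h1' : (f, -(-g₁)) ∈ (opProd ddt ddt).graph := by rwa [neg_neg]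
      obtain ⟨a, h3, h4⟩ := mem_graph_opProd.1 h2
      have h2' : (f, -g₂) ∈ (opProd Aminus Aminus).graph := by
        refine mem_graph_opProd.2 ⟨(-Complex.I) • a, mem_graph_smul.2 ⟨a, h3, rfl⟩,
          mem_graph_smul.2 ⟨(-Complex.I) • g₂, Submodule.smul_mem _ (-Complex.I) h4, ?_⟩⟩
        rw [smul_smul, neg_mul_neg, Complex.I_mul_I, neg_one_smul]
      exact ⟨-g₁, -g₂, mem_graph_neg.2 h1', h2', h.unique (hsym h1' h2')⟩

/-- The symbol `1 / (|2πξ|² + k²)` of the free resolvent. -/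
def resSymbol (k : ℝ) (ξ : Plane) : ℂ := (((laplSymbol ξ + k ^ 2)⁻¹ : ℝ) : ℂ)

/-- The free resolvent `(H₀ + k²)⁻¹`. -/
def freeRes (k : ℝ) : L2 →L[ℂ] L2 := fmul (resSymbol k)

/-- The operator `A₋ (H₀ + k²)⁻¹`. -/
def gradRes (k : ℝ) : L2 →L[ℂ] L2 := fmul fun ξ => (freq 1 ξ : ℂ) * resSymbol k ξ

variable {k : ℝ}

theorem laplSymbol_add_pos (hk : 1 ≤ k) (ξ : Plane) : 0 < laplSymbol ξ + k ^ 2 := by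
  have := laplSymbol_nonneg ξ
  positivity

theorem bddBy_resSymbol (hk : 1 ≤ k) : BddBy (resSymbol k) k⁻¹ where
  measurable := by
    have := measurable_laplSymbol
    unfold resSymbol
    fun_prop
  norm_le ξ := by
    have h := laplSymbol_nonneg ξ
    rw [resSymbol, Complex.norm_real, norm_inv, Real.norm_of_nonneg (laplSymbol_add_pos hk ξ).le]
    exact inv_anti₀ (by linarith) (by nlinarith)

theorem bddBy_freq_mul_resSymbol (hk : 1 ≤ k) (i : Fin 2) :
    BddBy (fun ξ => (freq i ξ : ℂ) * resSymbol k ξ) k⁻¹ where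
  measurable := by
    have := measurable_freq i
    have := (bddBy_resSymbol hk).measurable
    fun_prop
  norm_le ξ := by
    have h := laplSymbol_add_pos hk ξ
    have h1 := abs_freq_mul_le i i ξ
    rw [norm_mul, resSymbol, Complex.norm_real, Complex.norm_real, norm_inv,
      Real.norm_of_nonneg h.le, Real.norm_eq_abs, ← div_eq_mul_inv, div_le_iff₀ h,
      le_inv_mul_iff₀ (by linarith)]
    -- The claim k |ν| ≤ |2πξ|² + k², with ν = 2πξ_i, follows from 2 k |ν| ≤ ν² + k².
    nlinarith [sq_nonneg (|freq i ξ| - k), abs_nonneg (freq i ξ)]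

theorem isNegResolvent_freeRes (hk : 1 ≤ k) : IsNegResolvent H0 (k ^ 2) (freeRes k) where
  selfAdjoint := (bddBy_resSymbol hk).fmul_isSelfAdjoint fun ξ => Complex.conj_ofReal _
  injective f hf := by
    have h := (bddBy_resSymbol hk).hasSymbol_fmul f
    rw [← freeRes, hf] at h
    have h0 : ft (0 : L2) =ᵐ[volume] fun _ => (0 : ℂ) := by
      rw [map_zero]; exact Lp.coeFn_zero ℂ 2 volume
    refine ft.injective (Lp.ext ?_)
    filter_upwards [h, h0] with ξ h1 h2
    rw [h2] at h1 ⊢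
    refine (mul_eq_zero.1 h1.symm).resolve_left ?_
    exact Complex.ofReal_ne_zero.2 (inv_ne_zero (laplSymbol_add_pos hk ξ).ne')
  graph_iff u v := by
    have hne : ∀ ξ, ((laplSymbol ξ : ℂ) + (k : ℂ) ^ 2) ≠ 0 := fun ξ => by
      exact_mod_cast (laplSymbol_add_pos hk ξ).ne'
    rw [mem_graph_H0]
    constructor
    · intro h
      have hu : u = freeRes k (v + ((k ^ 2 : ℝ) : ℂ) • u) := by
        have h1 := (h.add ((hasSymbol_one u).smul ((k ^ 2 : ℝ) : ℂ))).comp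
          ((bddBy_resSymbol hk).hasSymbol_fmul _)
        refine (hasSymbol_one u).unique (h1.congr fun ξ => ?_)
        rw [resSymbol]
        push_cast
        rw [mul_one, inv_mul_cancel₀ (hne ξ)]
      refine ⟨_, hu, ?_⟩
      rw [← hu, add_sub_cancel_right]
    · rintro ⟨g, rfl, rfl⟩
      have h1 := (bddBy_resSymbol hk).hasSymbol_fmul g
      refine h1.of_comp (m' := fun ξ => (laplSymbol ξ : ℂ)) ?_
      rw [sub_eq_add_neg, ← neg_smul]
      refine ((hasSymbol_one g).add (h1.smul _)).congr fun ξ => ?_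
      rw [resSymbol]
      push_cast
      have := hne ξ
      field_simp
      ring

/-! ### First order perturbations -/

/-- The bounded self-adjoint operator `b` satisfies `∂ₜ b = b ∂ₜ + b₁` and `A₋ b = b A₋ + c`. -/
structure IsSmooth (b b₁ c : L2 →L[ℂ] L2) : Prop where
  selfAdjoint : IsSelfAdjoint b
  ddt : ∀ {f g : L2}, (f, g) ∈ ddt.graph → (b f, b g + b₁ f) ∈ ddt.graph
  aminus : ∀ {f g : L2}, (f, g) ∈ Aminus.graph → (b f, b g + c f) ∈ Aminus.graph

/-- The operator `(b A₋ + A₋ b + b² + σ b₁) (H₀ + k²)⁻¹`. -/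
def pertOp (k : ℝ) (σ : ℂ) (b b₁ c : L2 →L[ℂ] L2) : L2 →L[ℂ] L2 :=
  (2 : ℂ) • (b * gradRes k) + c * freeRes k + b * (b * freeRes k) + σ • (b₁ * freeRes k)

/-- The terms contribute 2M/k, M/k, M²/k and M/k. The bound depends on the coefficients only through
M, so it is insensitive to the cutoff. -/
theorem norm_pertOp_le {σ : ℂ} {b b₁ c : L2 →L[ℂ] L2} {M : ℝ} (hσ : ‖σ‖ ≤ 1) (hb : ‖b‖ ≤ M)
    (hb₁ : ‖b₁‖ ≤ M) (hc : ‖c‖ ≤ M) (hk : 1 ≤ k) (hM : 2 * (4 * M + M ^ 2) ≤ k) :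
    ‖pertOp k σ b b₁ c‖ ≤ 1 / 2 := by
  have hM0 : 0 ≤ M := (norm_nonneg _).trans hb
  have hR : ‖freeRes k‖ ≤ k⁻¹ := (bddBy_resSymbol hk).norm_fmul_le
  have hP : ‖gradRes k‖ ≤ k⁻¹ := (bddBy_freq_mul_resSymbol hk 1).norm_fmul_le
  have hmul : ∀ {x y : L2 →L[ℂ] L2} {p q : ℝ}, ‖x‖ ≤ p → ‖y‖ ≤ q → ‖x * y‖ ≤ p * q :=
    fun hx hy => (norm_mul_le _ _).trans
      (mul_le_mul hx hy (norm_nonneg _) ((norm_nonneg _).trans hx))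
  have h1 : ‖(2 : ℂ) • (b * gradRes k)‖ ≤ 2 * (M * k⁻¹) := by
    rw [norm_smul, Complex.norm_ofNat]
    exact mul_le_mul_of_nonneg_left (hmul hb hP) zero_le_two
  have h2 := hmul hc hR
  have h3 := hmul hb (hmul hb hR)
  have h4 : ‖σ • (b₁ * freeRes k)‖ ≤ 1 * (M * k⁻¹) := by
    rw [norm_smul]
    exact mul_le_mul hσ (hmul hb₁ hR) (norm_nonneg _) zero_le_one
  have h5 : ‖pertOp k σ b b₁ c‖ ≤ 2 * (M * k⁻¹) + M * k⁻¹ + M * (M * k⁻¹) + 1 * (M * k⁻¹) :=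
    (norm_add_le _ _).trans (add_le_add ((norm_add_le _ _).trans
      (add_le_add ((norm_add_le _ _).trans (add_le_add h1 h2)) h3)) h4)
  refine h5.trans ?_
  have h6 : 2 * (M * k⁻¹) + M * k⁻¹ + M * (M * k⁻¹) + 1 * (M * k⁻¹) = (4 * M + M ^ 2) / k := by
    ring
  rw [h6, div_le_iff₀ (by linarith)]
  linarith

/-- `w = ε ∂ₜ u + A₋ u + b u`, where `u` belongs to the domains of `∂ₜ` and `A₋`. -/
def FirstOrder (ε : ℝ) (b : L2 →L[ℂ] L2) (u w : L2) : Prop :=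
  ∃ ut ux, (u, ut) ∈ ddt.graph ∧ (u, ux) ∈ Aminus.graph ∧ w = (ε : ℂ) • ut + ux + b u

theorem ddt_inner {f f' g g' : L2} (h : (f, f') ∈ ddt.graph) (h' : (g, g') ∈ ddt.graph) :
    inner ℂ f' g = -inner ℂ f g' := by
  have h1 := (mem_graph_ddt.1 h').smul (-1)
  rw [neg_one_smul] at h1
  have h2 := (mem_graph_ddt.1 h).inner_eq (h1.congr fun ξ => by simp)
  rw [h2, inner_neg_right]

theorem Aminus_inner {f f' g g' : L2} (h : (f, f') ∈ Aminus.graph) (h' : (g, g') ∈ Aminus.graph) :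
    inner ℂ f' g = inner ℂ f g' :=
  (mem_graph_Aminus.1 h).inner_eq ((mem_graph_Aminus.1 h').congr fun ξ => by simp)

theorem FirstOrder.inner_eq {ε : ℝ} {b : L2 →L[ℂ] L2} (hb : IsSelfAdjoint b) {u w u' w' : L2}
    (h : FirstOrder ε b u w) (h' : FirstOrder (-ε) b u' w') : inner ℂ w u' = inner ℂ u w' := by
  obtain ⟨ut, ux, h1, h2, rfl⟩ := h
  obtain ⟨ut', ux', h3, h4, rfl⟩ := h'
  have h5 : inner ℂ (b u) u' = inner ℂ u (b u') :=
    (ContinuousLinearMap.isSelfAdjoint_iff_isSymmetric.1 hb) u u'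
  simp only [inner_add_left, inner_add_right, inner_smul_left, inner_smul_right, h5,
    ddt_inner h1 h3, Aminus_inner h2 h4, Complex.conj_ofReal]
  push_cast
  ring

/-- The same vector `utx` serves as A₋ ∂ₜ u and as ∂ₜ A₋ u, for u in the range of the free
resolvent; this is what cancels the mixed terms in the product of the first order operators. -/
theorem exists_derivatives (hk : 1 ≤ k) (g : L2) : ∃ ut utt utx uxx : L2,
    (freeRes k g, ut) ∈ ddt.graph ∧ (freeRes k g, gradRes k g) ∈ Aminus.graph ∧
    (ut, utt) ∈ ddt.graph ∧ (ut, utx) ∈ Aminus.graph ∧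
    (gradRes k g, utx) ∈ ddt.graph ∧ (gradRes k g, uxx) ∈ Aminus.graph ∧
    uxx - utt = g - ((k ^ 2 : ℝ) : ℂ) • freeRes k g := by
  have hu := (bddBy_resSymbol hk).hasSymbol_fmul g
  have hx := (bddBy_freq_mul_resSymbol hk 1).hasSymbol_fmul g
  have hux : HasSymbol (fun ξ => (freq 1 ξ : ℂ)) (freeRes k g) (gradRes k g) := hu.of_comp hx
  have hH : HasSymbol (fun ξ => (laplSymbol ξ : ℂ)) (freeRes k g)
      (g - ((k ^ 2 : ℝ) : ℂ) • freeRes k g) :=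
    mem_graph_H0.1 (((isNegResolvent_freeRes hk).graph_iff _ _).2 ⟨g, rfl, rfl⟩)
  obtain ⟨ut, hut⟩ := hH.exists_of_le (C := 1)
    (m' := fun ξ => Complex.I * (freq 0 ξ : ℂ)) (by have := measurable_freq 0; fun_prop) (by
      intro ξ
      rw [norm_mul, Complex.norm_I, one_mul, one_mul, Complex.norm_real, Complex.norm_real,
        Real.norm_of_nonneg (laplSymbol_nonneg ξ)]
      exact abs_freq_le 0 ξ)
  obtain ⟨utt, hutt⟩ := hH.exists_of_le (C := 1)
    (m' := fun ξ => Complex.I * (freq 0 ξ : ℂ) * (Complex.I * (freq 0 ξ : ℂ)))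
    (by have := measurable_freq 0; fun_prop) (by
      intro ξ
      rw [norm_mul, norm_mul, Complex.norm_I, one_mul, one_mul, Complex.norm_real,
        Complex.norm_real, Real.norm_of_nonneg (laplSymbol_nonneg ξ)]
      exact (abs_freq_mul_le 0 0 ξ).trans (by linarith))
  obtain ⟨utx, hutx⟩ := hH.exists_of_le (C := 1)
    (m' := fun ξ => (freq 1 ξ : ℂ) * (Complex.I * (freq 0 ξ : ℂ)))
    (by have := measurable_freq 0; have := measurable_freq 1; fun_prop) (by
      intro ξ
      rw [norm_mul, norm_mul, Complex.norm_I, one_mul, one_mul, Complex.norm_real,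
        Complex.norm_real, Complex.norm_real, Real.norm_of_nonneg (laplSymbol_nonneg ξ)]
      exact (abs_freq_mul_le 1 0 ξ).trans (by linarith))
  have hutx' : HasSymbol (fun ξ => Complex.I * (freq 0 ξ : ℂ)) (gradRes k g) utx :=
    hux.of_comp (hutx.congr fun ξ => mul_comm _ _)
  have huxx : HasSymbol (fun ξ => (freq 1 ξ : ℂ) * (freq 1 ξ : ℂ)) (freeRes k g)
      (utt + (g - ((k ^ 2 : ℝ) : ℂ) • freeRes k g)) := by
    refine (hutt.add hH).congr fun ξ => ?_
    rw [laplSymbol]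
    push_cast
    linear_combination ((freq 0 ξ : ℂ) ^ 2) * Complex.I_sq
  exact ⟨ut, utt, utx, _, mem_graph_ddt.2 hut, mem_graph_Aminus.2 hux,
    mem_graph_ddt.2 (hut.of_comp hutt), mem_graph_Aminus.2 (hut.of_comp hutx),
    mem_graph_ddt.2 hutx', mem_graph_Aminus.2 (hux.of_comp huxx), add_sub_cancel_left _ _⟩

theorem graph_add {T : L2 →ₗ.[ℂ] L2} {f g f' g' : L2} (h : (f, g) ∈ T.graph)
    (h' : (f', g') ∈ T.graph) : (f + f', g + g') ∈ T.graph :=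
  T.graph.add_mem h h'

theorem graph_sub {T : L2 →ₗ.[ℂ] L2} {f g f' g' : L2} (h : (f, g) ∈ T.graph)
    (h' : (f', g') ∈ T.graph) : (f - f', g - g') ∈ T.graph :=
  T.graph.sub_mem h h'

theorem graph_smul {T : L2 →ₗ.[ℂ] L2} {f g : L2} (c : ℂ) (h : (f, g) ∈ T.graph) :
    (c • f, c • g) ∈ T.graph :=
  T.graph.smul_mem c h

section

variable {b b₁ c : L2 →L[ℂ] L2} {ε : ℝ}

/-- On the range of the free resolvent, the product of the two first order operators is the
perturbed operator. -/
theorem IsSmooth.firstOrder_firstOrder (hb : IsSmooth b b₁ c) (hε : ε ^ 2 = 1) (hk : 1 ≤ k)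
    (g : L2) : ∃ w, FirstOrder ε b (freeRes k g) w ∧ FirstOrder (-ε) b w
      (g - ((k ^ 2 : ℝ) : ℂ) • freeRes k g + pertOp k (-(ε : ℂ)) b b₁ c g) := by
  obtain ⟨ut, utt, utx, uxx, h1, h2, h3, h4, h5, h6, h7⟩ := exists_derivatives hk g
  refine ⟨_, ⟨ut, _, h1, h2, rfl⟩, _, _,
    graph_add (graph_add (graph_smul (ε : ℂ) h3) h5) (hb.ddt h1),
    graph_add (graph_add (graph_smul (ε : ℂ) h4) h6) (hb.aminus h2), ?_⟩
  have hε' : (ε : ℂ) * ε = 1 := by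
    rw [← sq]; exact_mod_cast hε
  have hp : pertOp k (-(ε : ℂ)) b b₁ c g = (2 : ℂ) • b (gradRes k g) + c (freeRes k g) +
      b (b (freeRes k g)) + (-(ε : ℂ)) • b₁ (freeRes k g) := rfl
  -- The mixed terms ε `utx` cancel, ε² = 1 leaves `uxx - utt`, and the terms ±ε b ∂ₜ u cancel; of
  -- the commutators with b there remain c u and -ε b₁ u.
  rw [hp, ← h7, two_smul]
  simp only [map_add, map_smul, smul_add, smul_smul, Complex.ofReal_neg, neg_mul, hε', neg_smul,
    one_smul]
  abel

theorem FirstOrder.unique {u w w' : L2} (h : FirstOrder ε b u w) (h' : FirstOrder ε b u w') :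
    w = w' := by
  obtain ⟨ut, ux, h1, h2, rfl⟩ := h
  obtain ⟨ut', ux', h3, h4, rfl⟩ := h'
  rw [graph_unique h1 h3, graph_unique h2 h4]

/-- Elliptic regularity for the first order operator. -/
theorem IsSmooth.mem_range_freeRes (hb : IsSmooth b b₁ c) (hε : ε ^ 2 = 1) (hk : 1 ≤ k)
    {u w v : L2} (h : FirstOrder ε b u w) (h' : FirstOrder (-ε) b w v) :
    ∃ g, u = freeRes k g := by
  obtain ⟨ut, ux, h1, h2, rfl⟩ := h
  obtain ⟨wt, wx, h3, h4, -⟩ := h'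
  -- By the product rule b u lies in both derivative domains, hence so does w - b u = ε ∂ₜ u + A₋ u.
  -- Applying -ε ∂ₜ + A₋ to it produces the symbol of H₀, so u is in W^{2,2}.
  have h5 := graph_sub h3 (hb.ddt h1)
  have h6 := graph_sub h4 (hb.aminus h2)
  rw [add_sub_cancel_right] at h5 h6
  have h7 := ((mem_graph_ddt.1 h1).smul (ε : ℂ)).add (mem_graph_Aminus.1 h2)
  have h8 := h7.comp (((mem_graph_ddt.1 h5).smul (-(ε : ℂ))).add (mem_graph_Aminus.1 h6))
  have h9 : HasSymbol (fun ξ => (laplSymbol ξ : ℂ)) u _ := h8.congr fun ξ => by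
    have hε' : (ε : ℂ) ^ 2 = 1 := by exact_mod_cast hε
    rw [laplSymbol]
    push_cast
    linear_combination (-(ε : ℂ) ^ 2 * (freq 0 ξ : ℂ) ^ 2) * Complex.I_sq +
      (freq 0 ξ : ℂ) ^ 2 * hε'
  obtain ⟨g, hg, -⟩ := ((isNegResolvent_freeRes hk).graph_iff _ _).1 (mem_graph_H0.2 h9)
  exact ⟨g, hg⟩

theorem IsSmooth.firstOrder_iff (hb : IsSmooth b b₁ c) (hε : ε ^ 2 = 1) (hk : 1 ≤ k) (u v : L2) :
    (∃ w, FirstOrder ε b u w ∧ FirstOrder (-ε) b w v) ↔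
      ∃ g, u = freeRes k g ∧
        v = g - ((k ^ 2 : ℝ) : ℂ) • freeRes k g + pertOp k (-(ε : ℂ)) b b₁ c g := by
  constructor
  · rintro ⟨w, h1, h2⟩
    obtain ⟨g, rfl⟩ := hb.mem_range_freeRes hε hk h1 h2
    obtain ⟨w', h3, h4⟩ := hb.firstOrder_firstOrder hε hk g
    obtain rfl := h1.unique h3
    exact ⟨g, rfl, h2.unique h4⟩
  · rintro ⟨g, rfl, rfl⟩
    exact hb.firstOrder_firstOrder hε hk g

theorem IsSmooth.isRelPerturbation (hb : IsSmooth b b₁ c) (hε : ε ^ 2 = 1) (hk : 1 ≤ k)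
    (hW : ‖pertOp k (-(ε : ℂ)) b b₁ c‖ ≤ 1 / 2) {T : L2 →ₗ.[ℂ] L2}
    (hT : ∀ u v, (u, v) ∈ T.graph ↔ ∃ g, u = freeRes k g ∧
      v = g - ((k ^ 2 : ℝ) : ℂ) • freeRes k g + pertOp k (-(ε : ℂ)) b b₁ c g) :
    IsRelPerturbation T (k ^ 2) (freeRes k) (pertOp k (-(ε : ℂ)) b b₁ c) where
  graph_iff := hT
  norm_le := hW
  nonneg u v huv := by
    -- Nonnegativity comes from the factorization: ⟪u, D_{-ε} D_ε u⟫ = ‖D_ε u‖².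
    obtain ⟨w, h1, h2⟩ := (hb.firstOrder_iff hε hk u v).2 ((hT u v).1 huv)
    refine ⟨‖w‖ ^ 2, by positivity, ?_⟩
    rw [← h1.inner_eq hb.selfAdjoint h2, inner_self_eq_norm_sq_to_K]
    push_cast
    rfl

theorem IsSmooth.mem_graph_sum (hb : IsSmooth b b₁ c) (hk : 1 ≤ k) (σ : ℂ) (u v : L2) :
    (u, v) ∈ (H0 + opProd (ofBounded b) Aminus + opProd Aminus (ofBounded b) +
        opProd (ofBounded b) (ofBounded b) + σ • ofBounded b₁).graph ↔
      ∃ g, u = freeRes k g ∧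
        v = g - ((k ^ 2 : ℝ) : ℂ) • freeRes k g + pertOp k σ b b₁ c g := by
  have hval : ∀ g, (freeRes k g,
      g - ((k ^ 2 : ℝ) : ℂ) • freeRes k g + pertOp k σ b b₁ c g) ∈
      (H0 + opProd (ofBounded b) Aminus + opProd Aminus (ofBounded b) +
        opProd (ofBounded b) (ofBounded b) + σ • ofBounded b₁).graph := by
    intro g
    obtain ⟨ut, utt, utx, uxx, -, h2, -⟩ := exists_derivatives hk g
    have hH := ((isNegResolvent_freeRes hk).graph_iff _ _).2 ⟨g, rfl, rfl⟩
    have hB : ∀ {K : L2 →L[ℂ] L2} (f : L2), (f, K f) ∈ (ofBounded K).graph :=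
      fun f => mem_graph_ofBounded.2 rfl
    refine mem_graph_add.2 ⟨_, _, mem_graph_add.2 ⟨_, _, mem_graph_add.2 ⟨_, _, mem_graph_add.2
      ⟨_, _, hH, mem_graph_opProd.2 ⟨_, h2, hB _⟩, rfl⟩,
      mem_graph_opProd.2 ⟨_, hB _, hb.aminus h2⟩, rfl⟩,
      mem_graph_opProd.2 ⟨_, hB _, hB _⟩, rfl⟩, mem_graph_smul.2 ⟨_, hB _, rfl⟩, ?_⟩
    have hp : pertOp k σ b b₁ c g = (2 : ℂ) • b (gradRes k g) + c (freeRes k g) +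
      b (b (freeRes k g)) + σ • b₁ (freeRes k g) := rfl
    rw [hp, two_smul]
    abel
  constructor
  · intro h
    -- The four sums are peeled off to reach the summand H₀, which alone determines the domain.
    obtain ⟨_, _, h1, -, -⟩ := mem_graph_add.1 h
    obtain ⟨_, _, h1, -, -⟩ := mem_graph_add.1 h1
    obtain ⟨_, _, h1, -, -⟩ := mem_graph_add.1 h1
    obtain ⟨_, _, h1, -, -⟩ := mem_graph_add.1 h1
    obtain ⟨g, rfl, -⟩ := ((isNegResolvent_freeRes hk).graph_iff _ _).1 h1
    exact ⟨g, rfl, graph_unique h (hval g)⟩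
  · rintro ⟨g, rfl, rfl⟩
    exact hval g

/-- Sandwiching with a real Fourier multiplier. -/
theorem IsSmooth.sandwich (hb : IsSmooth b b₁ c) {m : Plane → ℂ} {C : ℝ} (hm : BddBy m C)
    (hreal : ∀ p, conj (m p) = m p) :
    IsSmooth (fmul m * (b * fmul m)) (fmul m * (b₁ * fmul m)) (fmul m * (c * fmul m)) where
  selfAdjoint := by
    have h := (hm.fmul_isSelfAdjoint hreal).star_eq
    rw [IsSelfAdjoint, star_mul, star_mul, h, hb.selfAdjoint.star_eq, mul_assoc]
  ddt {f g} h := by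
    have h1 := mem_graph_ddt.1 (hb.ddt (mem_graph_ddt.2 ((mem_graph_ddt.1 h).fmul hm)))
    have h2 := mem_graph_ddt.2 (h1.fmul hm)
    rwa [map_add] at h2
  aminus {f g} h := by
    have h1 := mem_graph_Aminus.1 (hb.aminus (mem_graph_Aminus.2 ((mem_graph_Aminus.1 h).fmul hm)))
    have h2 := mem_graph_Aminus.2 (h1.fmul hm)
    rwa [map_add] at h2

end

/-! ### The model operators -/

section Model

variable {φ θ : ℝ → ℝ}

/-- The function `θ(t) φ(x)`. -/
def potB (φ θ : ℝ → ℝ) (p : Plane) : ℂ := ((θ (p 0) * φ (p 1) : ℝ) : ℂ)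

/-- The function `θ'(t) φ(x)`. -/
def potB' (φ θ : ℝ → ℝ) (p : Plane) : ℂ := ((deriv θ (p 0) * φ (p 1) : ℝ) : ℂ)

/-- The function `-i θ(t) φ'(x)`. -/
def potC (φ θ : ℝ → ℝ) (p : Plane) : ℂ := -Complex.I * ((deriv φ (p 1) * θ (p 0) : ℝ) : ℂ)

theorem Admissible.hasBddPartial (h : Admissible φ θ) :
    HasBddPartial 0 (potB φ θ) (potB' φ θ) ∧
      HasBddPartial 1 (potB φ θ) fun p => ((deriv φ (p 1) * θ (p 0) : ℝ) : ℂ) := by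
  obtain ⟨Lφ, hLφ⟩ := exists_lipschitzWith_of_ac h.phi_ac h.phi_deriv_bdd
  obtain ⟨Lθ, hLθ⟩ := exists_lipschitzWith_of_ac h.theta_ac h.theta_deriv_bdd
  obtain ⟨Cφ, hCφ⟩ := exists_abs_le_of_memLp_top hLφ.continuous h.phi_bdd
  obtain ⟨Cθ, hCθ⟩ := exists_abs_le_of_memLp_top hLθ.continuous h.theta_bdd
  refine ⟨hasBddPartial_prod 0 (by decide) hLθ hCθ hLφ.continuous.measurable hCφ, ?_⟩
  have h1 := hasBddPartial_prod 1 (j := 0) (by decide) hLφ hCφ hLθ.continuous.measurable hCθ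
  have h2 : potB φ θ = fun p => ((φ (p 1) * θ (p 0) : ℝ) : ℂ) :=
    funext fun p => congrArg _ (mul_comm _ _)
  rw [h2]
  exact h1

theorem Admissible.exists_bddBy (h : Admissible φ θ) :
    ∃ M, BddBy (potB φ θ) M ∧ BddBy (potB' φ θ) M ∧ BddBy (potC φ θ) M := by
  obtain ⟨h0, h1⟩ := h.hasBddPartial
  obtain ⟨M₁, hM₁⟩ := h0.bdd
  obtain ⟨M₂, hM₂⟩ := h0.bdd_deriv
  obtain ⟨M₃, hM₃⟩ := h1.bdd_deriv
  have hM₃' : BddBy (potC φ θ) _ := hM₃.const_mul (-Complex.I)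
  refine ⟨max M₁ (max M₂ (‖-Complex.I‖ * M₃)), ⟨hM₁.1, fun p => ?_⟩, ⟨hM₂.1, fun p => ?_⟩,
    ⟨hM₃'.1, fun p => ?_⟩⟩
  · exact (hM₁.2 p).trans (le_max_left _ _)
  · exact (hM₂.2 p).trans ((le_max_left _ _).trans (le_max_right _ _))
  · exact (hM₃'.2 p).trans ((le_max_right _ _).trans (le_max_right _ _))

theorem Admissible.isSmooth (h : Admissible φ θ) :
    IsSmooth (bmul (potB φ θ)) (bmul (potB' φ θ)) (bmul (potC φ θ)) := by
  obtain ⟨h0, h1⟩ := h.hasBddPartial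
  obtain ⟨M, hB, -, hC⟩ := h.exists_bddBy
  obtain ⟨M', hM'⟩ := h1.bdd_deriv
  refine ⟨?_, fun hf => h0.weakDeriv_bmul hf, fun {f g} hf => ?_⟩
  · rw [IsSelfAdjoint, hB.star_bmul]
    congr 1
    exact funext fun p => Complex.conj_ofReal _
  · obtain ⟨g', hg', rfl⟩ := mem_graph_smul.1 hf
    refine mem_graph_smul.2 ⟨_, h1.weakDeriv_bmul hg', ?_⟩
    rw [smul_add, map_smul]
    congr 1
    refine Lp.ext ?_
    filter_upwards [hC.coeFn_bmul f, hM'.coeFn_bmul f,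
      Lp.coeFn_smul (-Complex.I) (bmul (fun p => ((deriv φ (p 1) * θ (p 0) : ℝ) : ℂ)) f)]
      with p h2 h3 h4
    rw [h2, h4, Pi.smul_apply, h3, smul_eq_mul, potC, mul_assoc]

theorem Admissible.B_eq (h : Admissible φ θ) : B φ θ = ofBounded (bmul (potB φ θ)) := by
  obtain ⟨M, hB, -, -⟩ := h.exists_bddBy
  exact hB.multOp_eq

theorem Admissible.B'_eq (h : Admissible φ θ) : B' φ θ = ofBounded (bmul (potB' φ θ)) := by
  obtain ⟨M, -, hB, -⟩ := h.exists_bddBy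
  exact hB.multOp_eq

/-! #### The approximations -/

theorem opProd_ofBounded (K K' : L2 →L[ℂ] L2) :
    opProd (ofBounded K) (ofBounded K') = ofBounded (K * K') := by
  refine eq_of_mem_graph_iff fun f g => ?_
  simp only [mem_graph_opProd, mem_graph_ofBounded, exists_eq_left, mul_apply_eq_comp]

/-- The symbol of `χ_n(A₋)`. -/
def chiSymbol (n : ℕ) (ξ : Plane) : ℂ := ((chi n (2 * Real.pi * ξ 1) : ℝ) : ℂ)

theorem abs_chi_le (n : ℕ) (ν : ℝ) : |chi n ν| ≤ 1 := by
  rw [chi, abs_div, abs_of_nonneg (Real.sqrt_nonneg _), Nat.abs_cast]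
  refine div_le_one_of_le₀ (Real.le_sqrt_of_sq_le ?_) (Real.sqrt_nonneg _)
  nlinarith [sq_nonneg ν]

theorem tendsto_chi (ν : ℝ) : Tendsto (fun n : ℕ => chi n ν) atTop (𝓝 1) := by
  have h1 : Tendsto (fun n : ℕ => (Real.sqrt ((ν / n) ^ 2 + 1))⁻¹) atTop (𝓝 1) := by
    have h2 := ((tendsto_const_div_atTop_nhds_zero_nat ν).pow 2).add_const 1
    have h3 := (h2.sqrt).inv₀ (by simp)
    simpa using h3
  refine h1.congr' ?_
  -- The rewriting divides by n; the value n = 0, where χ₀ vanishes identically, is discarded.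
  filter_upwards [eventually_gt_atTop 0] with n hn
  have hn' : (0 : ℝ) < n := Nat.cast_pos.2 hn
  have h2 : ν ^ 2 + (n : ℝ) ^ 2 = ((ν / n) ^ 2 + 1) * (n : ℝ) ^ 2 := by field_simp
  rw [chi, h2, Real.sqrt_mul (by positivity), Real.sqrt_sq hn'.le, div_mul_cancel_right₀ hn'.ne']

theorem bddBy_chiSymbol (n : ℕ) : BddBy (chiSymbol n) 1 where
  measurable := by unfold chiSymbol chi; fun_prop
  norm_le ξ := by rw [chiSymbol, Complex.norm_real]; exact abs_chi_le n _

theorem chiA_eq (n : ℕ) : chiA n = ofBounded (fmul (chiSymbol n)) := by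
  have h : multOp (fun ξ => ((chi n (2 * Real.pi * ξ 1) : ℝ) : ℂ)) =
      ofBounded (bmul (chiSymbol n)) := (bddBy_chiSymbol n).multOp_eq
  rw [chiA, h, opProd_ofBounded, opProd_ofBounded]
  rfl

/-- The sandwich `χ_n(A₋) b χ_n(A₋)`. -/
def cutoff (n : ℕ) (b : L2 →L[ℂ] L2) : L2 →L[ℂ] L2 :=
  fmul (chiSymbol n) * (b * fmul (chiSymbol n))

theorem norm_cutoff_le (n : ℕ) {b : L2 →L[ℂ] L2} {M : ℝ} (hb : ‖b‖ ≤ M) : ‖cutoff n b‖ ≤ M := by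
  have h := (bddBy_chiSymbol n).norm_fmul_le
  calc ‖cutoff n b‖ ≤ ‖fmul (chiSymbol n)‖ * (‖b‖ * ‖fmul (chiSymbol n)‖) :=
        (norm_mul_le _ _).trans (by gcongr; exact norm_mul_le _ _)
    _ ≤ 1 * (M * 1) := by gcongr; exact (norm_nonneg _).trans hb
    _ = M := by ring

theorem tendsto_fmul_chiSymbol (f : L2) :
    Tendsto (fun n => fmul (chiSymbol n) f) atTop (𝓝 f) := by
  have h1 : BddBy (fun _ : Plane => (1 : ℂ)) 1 := ⟨measurable_const, fun _ => by simp⟩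
  have h := tendsto_fmul bddBy_chiSymbol h1 (Eventually.of_forall fun p =>
    (Complex.continuous_ofReal.tendsto _).comp (tendsto_chi (2 * Real.pi * p 1))) f
  rwa [(h1.hasSymbol_fmul f).unique (hasSymbol_one f)] at h

theorem tendsto_cutoff (b : L2 →L[ℂ] L2) (f : L2) :
    Tendsto (fun n => cutoff n b f) atTop (𝓝 (b f)) :=
  tendsto_apply_of_tendsto (K := fun n => fmul (chiSymbol n)) (K' := 1)
    (fun n => (bddBy_chiSymbol n).norm_fmul_le) tendsto_fmul_chiSymbol
    ((b.continuous.tendsto _).comp (tendsto_fmul_chiSymbol f))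

theorem tendsto_pertOp_cutoff (k : ℝ) (σ : ℂ) (b b₁ c : L2 →L[ℂ] L2) (f : L2) :
    Tendsto (fun n => pertOp k σ (cutoff n b) (cutoff n b₁) (cutoff n c) f) atTop
      (𝓝 (pertOp k σ b b₁ c f)) :=
  ((((tendsto_cutoff b _).const_smul (2 : ℂ)).add (tendsto_cutoff c _)).add
    (tendsto_apply_of_tendsto (fun n => norm_cutoff_le n le_rfl) (tendsto_cutoff b)
      (tendsto_cutoff b _))).add ((tendsto_cutoff b₁ _).const_smul σ)

theorem IsSmooth.cutoff {b b₁ c : L2 →L[ℂ] L2} (hb : IsSmooth b b₁ c) (n : ℕ) :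
    IsSmooth (cutoff n b) (cutoff n b₁) (cutoff n c) :=
  hb.sandwich (bddBy_chiSymbol n) fun _ => Complex.conj_ofReal _

theorem Admissible.Hn_eq (h : Admissible φ θ) (j n : ℕ) :
    Hn φ θ j n = H0 + opProd (ofBounded (ModelOperator.cutoff n (bmul (potB φ θ)))) Aminus +
      opProd Aminus (ofBounded (ModelOperator.cutoff n (bmul (potB φ θ)))) +
      opProd (ofBounded (ModelOperator.cutoff n (bmul (potB φ θ))))
        (ofBounded (ModelOperator.cutoff n (bmul (potB φ θ)))) +
      ((-1 : ℂ) ^ j) • ofBounded (ModelOperator.cutoff n (bmul (potB' φ θ))) := by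
  have hB : Bn φ θ n = ofBounded (ModelOperator.cutoff n (bmul (potB φ θ))) := by
    rw [Bn, h.B_eq, chiA_eq, opProd_ofBounded, opProd_ofBounded]
    rfl
  have hB' : Bn' φ θ n = ofBounded (ModelOperator.cutoff n (bmul (potB' φ θ))) := by
    rw [Bn', h.B'_eq, chiA_eq, opProd_ofBounded, opProd_ofBounded]
    rfl
  rw [Hn, hB, hB']

/-! #### The limit operator -/

theorem Admissible.mem_graph_DA (h : Admissible φ θ) (f g : L2) :
    (f, g) ∈ (DA φ θ).graph ↔ FirstOrder 1 (bmul (potB φ θ)) f g := by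
  rw [DA, A, h.B_eq, mem_graph_add]
  constructor
  · rintro ⟨ft, g₂, h1, h2, rfl⟩
    obtain ⟨fx, g₃, h3, h4, rfl⟩ := mem_graph_add.1 h2
    refine ⟨ft, fx, h1, h3, ?_⟩
    rw [mem_graph_ofBounded.1 h4, Complex.ofReal_one, one_smul, add_assoc]
  · rintro ⟨ft, fx, h1, h2, rfl⟩
    refine ⟨ft, _, h1, mem_graph_add.2 ⟨fx, _, h2, mem_graph_ofBounded.2 rfl, rfl⟩, ?_⟩
    rw [Complex.ofReal_one, one_smul, add_assoc]

theorem Admissible.dense_domain_DA (h : Admissible φ θ) :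
    Dense ((DA φ θ).domain : Set L2) := by
  refine (isNegResolvent_freeRes le_rfl).dense_domain.mono fun u hu => ?_
  obtain ⟨v, hv⟩ := LinearPMap.mem_domain_iff.1 hu
  obtain ⟨g, rfl, -⟩ := ((isNegResolvent_freeRes le_rfl).graph_iff _ _).1 hv
  obtain ⟨ut, utt, utx, uxx, h1, h2, -⟩ := exists_derivatives le_rfl g
  exact LinearPMap.mem_domain_of_mem_graph ((h.mem_graph_DA _ _).2 ⟨ut, _, h1, h2, rfl⟩)

/-- If `⟪g, u⟫ = ⟪f, ∂ₜ u + A₋ u⟫` for all `u` in `W^{2,2}`, then `f` belongs to the domains of `∂ₜ`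
and `A₋`, and `g = -∂ₜ f + A₋ f`. -/
theorem exists_of_forall_inner_eq {f g : L2}
    (h : ∀ u ut ux, (u, ut) ∈ ddt.graph → (u, ux) ∈ Aminus.graph →
      inner ℂ g u = inner ℂ f (ut + ux)) :
    ∃ ft fx, (f, ft) ∈ ddt.graph ∧ (f, fx) ∈ Aminus.graph ∧ g = (-1 : ℂ) • ft + fx := by
  -- The identity is tested on u = (H₀ + 1)⁻¹ x with x arbitrary, where the derivatives are bounded
  -- multipliers of x. This determines (H₀ + 1)⁻¹ g, and cancelling the nonvanishing resolvent
  -- symbol recovers g.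
  have hρ := bddBy_resSymbol (le_refl (1 : ℝ))
  have hρ0 := (bddBy_freq_mul_resSymbol (le_refl (1 : ℝ)) 0).const_mul Complex.I
  have hρ1 := bddBy_freq_mul_resSymbol (le_refl (1 : ℝ)) 1
  have hreal : ∀ ξ, conj (resSymbol 1 ξ) = resSymbol 1 ξ := fun ξ => Complex.conj_ofReal _
  obtain ⟨y, hy⟩ : ∃ y, HasSymbol (fun ξ => conj (Complex.I * ((freq 0 ξ : ℂ) * resSymbol 1 ξ)) +
      (freq 1 ξ : ℂ) * resSymbol 1 ξ) f y :=
    ⟨_, (hρ0.conj.hasSymbol_fmul f).add (hρ1.hasSymbol_fmul f)⟩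
  have h1 : ∀ x, inner ℂ (freeRes 1 g) x = inner ℂ y x := by
    intro x
    have hx := hρ.hasSymbol_fmul x
    have hx0 := hρ0.hasSymbol_fmul x
    have hx1 := hρ1.hasSymbol_fmul x
    have h2 := h _ _ _
      (mem_graph_ddt.2 (hx.of_comp (hx0.congr fun ξ => (mul_assoc _ _ _).symm)))
      (mem_graph_Aminus.2 (hx.of_comp hx1))
    have h3 : inner ℂ (freeRes 1 g) x = inner ℂ g (fmul (resSymbol 1) x) :=
      (hρ.hasSymbol_fmul g).inner_eq (hx.congr fun ξ => (hreal ξ).symm)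
    rw [h3, h2]
    refine (hy.inner_eq ((hx0.add hx1).congr fun ξ => ?_)).symm
    simp [hreal]
  have h2 : freeRes 1 g = y := ext_inner_right ℂ h1
  have h3 : HasSymbol (fun ξ => -(Complex.I * (freq 0 ξ : ℂ)) + (freq 1 ξ : ℂ)) f g := by
    have h4 := hρ.hasSymbol_fmul g
    rw [← freeRes, h2] at h4
    filter_upwards [h4, hy] with ξ h6 h7
    have hne : resSymbol 1 ξ ≠ 0 :=
      Complex.ofReal_ne_zero.2 (inv_ne_zero (laplSymbol_add_pos le_rfl ξ).ne')
    refine mul_left_cancel₀ hne ?_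
    rw [← h6, h7]
    simp only [map_mul, hreal, Complex.conj_I, Complex.conj_ofReal]
    ring
  -- Ellipticity of -∂ₜ + A₋: the frequencies are, up to sign, the imaginary and real parts of its
  -- symbol, so its modulus controls each derivative separately.
  have hre : ∀ ξ, (-(Complex.I * (freq 0 ξ : ℂ)) + (freq 1 ξ : ℂ)).re = freq 1 ξ := by simp
  have him : ∀ ξ, (-(Complex.I * (freq 0 ξ : ℂ)) + (freq 1 ξ : ℂ)).im = -freq 0 ξ := by simp
  obtain ⟨ft, hft⟩ := h3.exists_of_le (C := 1)
    (m' := fun ξ => Complex.I * (freq 0 ξ : ℂ)) (by have := measurable_freq 0; fun_prop) (by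
      intro ξ
      have h4 := Complex.abs_im_le_norm (-(Complex.I * (freq 0 ξ : ℂ)) + (freq 1 ξ : ℂ))
      rw [him, abs_neg] at h4
      rw [norm_mul, Complex.norm_I, one_mul, one_mul, Complex.norm_real]
      exact h4.trans (by linarith))
  obtain ⟨fx, hfx⟩ := h3.exists_of_le (C := 1)
    (m' := fun ξ => (freq 1 ξ : ℂ)) (by have := measurable_freq 1; fun_prop) (by
      intro ξ
      have h4 := Complex.abs_re_le_norm (-(Complex.I * (freq 0 ξ : ℂ)) + (freq 1 ξ : ℂ))
      rw [hre] at h4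
      rw [one_mul, Complex.norm_real]
      exact h4.trans (by linarith))
  exact ⟨ft, fx, mem_graph_ddt.2 hft, mem_graph_Aminus.2 hfx,
    h3.unique (((hft.smul (-1)).add hfx).congr fun ξ => by rw [neg_one_mul])⟩

/-- The bounded self-adjoint part B moves across the inner product, which reduces the adjoint to
that of the constant coefficient operator ∂ₜ + A₋. -/
theorem Admissible.mem_graph_adjoint_DA (h : Admissible φ θ) (f g : L2) :
    (f, g) ∈ ((DA φ θ)†).graph ↔ FirstOrder (-1) (bmul (potB φ θ)) f g := by
  have hb := h.isSmooth.selfAdjoint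
  rw [mem_graph_adjoint h.dense_domain_DA]
  constructor
  · intro hfg
    have hsymm : ∀ x y, inner ℂ (bmul (potB φ θ) x) y = inner ℂ x (bmul (potB φ θ) y) :=
      ContinuousLinearMap.isSelfAdjoint_iff_isSymmetric.1 hb
    obtain ⟨ft, fx, h1, h2, h3⟩ := exists_of_forall_inner_eq (f := f)
      (g := g - bmul (potB φ θ) f) fun u ut ux h1 h2 => by
        rw [inner_sub_left, hfg _ _ ((h.mem_graph_DA _ _).2 ⟨ut, ux, h1, h2, rfl⟩), hsymm,
          Complex.ofReal_one, one_smul, inner_add_right, add_sub_cancel_right]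
    refine ⟨ft, fx, h1, h2, ?_⟩
    rw [Complex.ofReal_neg, Complex.ofReal_one, ← h3, sub_add_cancel]
  · intro hfg u v huv
    have h1 := ((h.mem_graph_DA _ _).1 huv).inner_eq hb hfg
    rw [← inner_conj_symm, ← h1, inner_conj_symm]

/-- The sign of the first order factor applied first in `H_j`. -/
def signOf (j : ℕ) : ℝ := -(-1) ^ j

theorem signOf_sq (j : ℕ) : signOf j ^ 2 = 1 := by
  rw [signOf, neg_sq, ← pow_mul, mul_comm, pow_mul, neg_one_sq, one_pow]

theorem neg_signOf (j : ℕ) : -(signOf j : ℂ) = (-1) ^ j := by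
  rw [signOf]
  push_cast
  rw [neg_neg]

theorem Admissible.mem_graph_H (h : Admissible φ θ) {j : ℕ} (hj : j = 1 ∨ j = 2) (u v : L2) :
    (u, v) ∈ (H φ θ j).graph ↔ ∃ w, FirstOrder (signOf j) (bmul (potB φ θ)) u w ∧
      FirstOrder (-signOf j) (bmul (potB φ θ)) w v := by
  rcases hj with rfl | rfl
  · have h1 : signOf 1 = 1 := by norm_num [signOf]
    rw [H, if_pos rfl, mem_graph_opProd, h1]
    simp only [h.mem_graph_DA, h.mem_graph_adjoint_DA]
  · have h1 : signOf 2 = -1 := by norm_num [signOf]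
    rw [H, if_neg (by decide), mem_graph_opProd, h1, neg_neg]
    simp only [h.mem_graph_DA, h.mem_graph_adjoint_DA]

/-- `H_j` and its approximations are nonnegative relatively bounded perturbations of `H₀`. -/
theorem Admissible.exists_isRelPerturbation (h : Admissible φ θ) :
    ∃ (k : ℝ) (W : ℕ → L2 →L[ℂ] L2) (Wn : ℕ → ℕ → L2 →L[ℂ] L2), 1 ≤ k ∧
      ∀ j, (j = 1 ∨ j = 2) →
        IsRelPerturbation (H φ θ j) (k ^ 2) (freeRes k) (W j) ∧
        (∀ n, IsRelPerturbation (Hn φ θ j n) (k ^ 2) (freeRes k) (Wn j n)) ∧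
        ∀ f, Tendsto (fun n => Wn j n f) atTop (𝓝 (W j f)) := by
  obtain ⟨M, hB, hB', hC⟩ := h.exists_bddBy
  have hM := hB.nonneg
  -- This meets both requirements of `norm_pertOp_le`. Cutting off does not increase M, so the same
  -- k serves H_j and every H_{j,n}, including n = 0.
  set k : ℝ := 1 + 2 * (4 * M + M ^ 2) with hk
  have hk1 : 1 ≤ k := by nlinarith
  have hs := h.isSmooth
  have hσ : ∀ j, ‖-(signOf j : ℂ)‖ ≤ 1 := fun j => by simp [neg_signOf]
  refine ⟨k, fun j => pertOp k (-(signOf j : ℂ)) (bmul (potB φ θ)) (bmul (potB' φ θ))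
    (bmul (potC φ θ)), fun j n => pertOp k (-(signOf j : ℂ)) (cutoff n (bmul (potB φ θ)))
    (cutoff n (bmul (potB' φ θ))) (cutoff n (bmul (potC φ θ))), hk1, fun j hj => ⟨?_, fun n => ?_,
      tendsto_pertOp_cutoff _ _ _ _ _⟩⟩
  · refine hs.isRelPerturbation (signOf_sq j) hk1 (norm_pertOp_le (hσ j) hB.norm_bmul_le
      hB'.norm_bmul_le hC.norm_bmul_le hk1 (by linarith)) fun u v => ?_
    rw [h.mem_graph_H hj, hs.firstOrder_iff (signOf_sq j) hk1]
  · refine (hs.cutoff n).isRelPerturbation (signOf_sq j) hk1 (norm_pertOp_le (hσ j)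
      (norm_cutoff_le n hB.norm_bmul_le) (norm_cutoff_le n hB'.norm_bmul_le)
      (norm_cutoff_le n hC.norm_bmul_le) hk1 (by linarith)) fun u v => ?_
    rw [h.Hn_eq, neg_signOf]
    exact (hs.cutoff n).mem_graph_sum hk1 _ u v

theorem IsRelPerturbation.leftProd_eq {T : L2 →ₗ.[ℂ] L2} {k : ℝ} {W : L2 →L[ℂ] L2} {z : ℂ}
    (hk : 1 ≤ k) (hT : IsRelPerturbation T (k ^ 2) (freeRes k) W)
    (hz : ¬ (z.im = 0 ∧ 0 ≤ z.re)) :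
    leftProd T z = ofBounded (pertLeft (k ^ 2 : ℝ) z (freeRes k) W) := by
  rw [leftProd]
  exact hT.opProd_left (isNegResolvent_freeRes hk) hz

theorem IsRelPerturbation.rightProd_closure {T : L2 →ₗ.[ℂ] L2} {k : ℝ} {W : L2 →L[ℂ] L2} {z : ℂ}
    (hk : 1 ≤ k) (hT : IsRelPerturbation T (k ^ 2) (freeRes k) W)
    (hz : ¬ (z.im = 0 ∧ 0 ≤ z.re)) :
    (rightProd T z).IsClosable ∧ (rightProd T z).closure =
      ofBounded (star (pertLeft (k ^ 2 : ℝ) (conj z) (freeRes k) W)) := by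
  rw [rightProd]
  exact hT.opProd_right (isNegResolvent_freeRes hk) hz

theorem IsRelPerturbation.rightProd_closure_eq_adjoint {T : L2 →ₗ.[ℂ] L2} {k : ℝ}
    {W : L2 →L[ℂ] L2} {z : ℂ} (hk : 1 ≤ k) (hT : IsRelPerturbation T (k ^ 2) (freeRes k) W)
    (hz : ¬ (z.im = 0 ∧ 0 ≤ z.re)) :
    (rightProd T z).closure = (leftProd T (conj z))† := by
  rw [(hT.rightProd_closure hk hz).2, hT.leftProd_eq hk (not_conj_nonneg hz), adjoint_ofBounded]

end Model

end

end ModelOperator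

set_option maxHeartbeats 1000000 in
theorem mainTheorem5 (φ θ : ℝ → ℝ) (hφθ : Admissible φ θ)
    (z : ℂ) (hz : ¬ (z.im = 0 ∧ 0 ≤ z.re)) :
    -- the resolvents in question exist
    (∀ j : ℕ, (j = 1 ∨ j = 2) →
      z ∈ resSet (H φ θ j) ∧
      ∀ n : ℕ, 1 ≤ n →
        z ∈ resSet (Hn φ θ j n) ∧ conj z ∈ resSet (Hn φ θ j n)) ∧
    -- (i) strong resolvent convergence
    (∀ j : ℕ, (j = 1 ∨ j = 2) → ∀ f : L2,
      Tendsto (fun n : ℕ => res (Hn φ θ j n) z f) atTop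
        (𝓝 (res (H φ θ j) z f))) ∧
    -- (ii) the formula for the closures
    (∀ j : ℕ, (j = 1 ∨ j = 2) → ∀ n : ℕ, 1 ≤ n →
      (rightProd (Hn φ θ j n) z).IsClosable ∧
      (rightProd (Hn φ θ j n) z).closure = (leftProd (Hn φ θ j n) (conj z))†) ∧
    -- (ii) boundedness, uniformly in `n`, and strong convergence
    ∃ C : ℝ, 0 < C ∧ ∀ j : ℕ, (j = 1 ∨ j = 2) →
      (∃ (K : ℕ → L2 →L[ℂ] L2) (Kinf : L2 →L[ℂ] L2),
        (∀ n : ℕ, 1 ≤ n → leftProd (Hn φ θ j n) z = ofBounded (K n) ∧ ‖K n‖ ≤ C) ∧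
        leftProd (H φ θ j) z = ofBounded Kinf ∧
        ∀ f : L2, Tendsto (fun n : ℕ => K n f) atTop (𝓝 (Kinf f))) ∧
      (∃ (L : ℕ → L2 →L[ℂ] L2) (Linf : L2 →L[ℂ] L2),
        (∀ n : ℕ, 1 ≤ n → (rightProd (Hn φ θ j n) z).closure = ofBounded (L n) ∧ ‖L n‖ ≤ C) ∧
        (rightProd (H φ θ j) z).IsClosable ∧
        (rightProd (H φ θ j) z).closure = ofBounded Linf ∧
        ∀ f : L2, Tendsto (fun n : ℕ => L n f) atTop (𝓝 (Linf f))) := by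
  obtain ⟨k, W, Wn, hk, hW⟩ := hφθ.exists_isRelPerturbation
  have hR := isNegResolvent_freeRes hk
  have hz' := not_conj_nonneg hz
  -- Two constants are needed: the left products are bounded at z, while the closures of the right
  -- products at z are adjoints of left products at the conjugate of z.
  obtain ⟨C₁, hC₁, hC₁'⟩ := exists_norm_pertLeft_le (k ^ 2) (freeRes k) hz
  obtain ⟨C₂, hC₂, hC₂'⟩ := exists_norm_pertLeft_le (k ^ 2) (freeRes k) hz'
  have h1 : ∀ j : ℕ, (j = 1 ∨ j = 2) → z ∈ resSet (H φ θ j) ∧ ∀ n : ℕ, 1 ≤ n →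
      z ∈ resSet (Hn φ θ j n) ∧ conj z ∈ resSet (Hn φ θ j n) := fun j hj => by
    obtain ⟨hT, hTn, -⟩ := hW j hj
    exact ⟨⟨_, hT.isResolventAt hz⟩, fun n _ =>
      ⟨⟨_, (hTn n).isResolventAt hz⟩, ⟨_, (hTn n).isResolventAt hz'⟩⟩⟩
  have h2 : ∀ j : ℕ, (j = 1 ∨ j = 2) → ∀ f : L2,
      Tendsto (fun n : ℕ => res (Hn φ θ j n) z f) atTop (𝓝 (res (H φ θ j) z f)) := fun j hj f => by
    obtain ⟨hT, hTn, hlim⟩ := hW j hj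
    simp only [hT.res_eq hz, fun n => (hTn n).res_eq hz]
    exact tendsto_pertRes hT hTn hlim hz f
  have h3 : ∀ j : ℕ, (j = 1 ∨ j = 2) → ∀ n : ℕ, 1 ≤ n →
      (rightProd (Hn φ θ j n) z).IsClosable ∧
      (rightProd (Hn φ θ j n) z).closure = (leftProd (Hn φ θ j n) (conj z))† := fun j hj n _ => by
    obtain ⟨-, hTn, -⟩ := hW j hj
    exact ⟨((hTn n).rightProd_closure hk hz).1, (hTn n).rightProd_closure_eq_adjoint hk hz⟩
  refine ⟨h1, h2, h3, max C₁ C₂, lt_max_of_lt_left hC₁, fun j hj => ?_⟩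
  obtain ⟨hT, hTn, hlim⟩ := hW j hj
  constructor
  · exact ⟨fun n => pertLeft (k ^ 2 : ℝ) z (freeRes k) (Wn j n),
      pertLeft (k ^ 2 : ℝ) z (freeRes k) (W j),
      fun n _ => ⟨(hTn n).leftProd_eq hk hz, (hC₁' _ _ (hTn n)).trans (le_max_left _ _)⟩,
      hT.leftProd_eq hk hz, tendsto_pertLeft hT hTn hlim hz⟩
  · refine ⟨fun n => star (pertLeft (k ^ 2 : ℝ) (conj z) (freeRes k) (Wn j n)),
      star (pertLeft (k ^ 2 : ℝ) (conj z) (freeRes k) (W j)),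
      fun n _ => ⟨((hTn n).rightProd_closure hk hz).2, ?_⟩,
      (hT.rightProd_closure hk hz).1, (hT.rightProd_closure hk hz).2,
      tendsto_star_pertLeft hR hT hTn hlim hz⟩
    exact (norm_star (pertLeft (k ^ 2 : ℝ) (conj z) (freeRes k) (Wn j n))).trans_le
      ((hC₂' _ _ (hTn n)).trans (le_max_right _ _))
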